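/- Let $M$ be a compact manifold with a foliation $\mathcal F$ of codimension $q$ and a bundle-like Riemannian metric $g$ for which all leaves are minimal submanifolds (so the mean curvature form $\kappa$ of the leaves vanishes). Let $N=TM/T\mathcal F$ be the normal bundle with the metric induced by $g$. Let $G\subset O(q)$ be a connected subgroup, and suppose that the bundle of orthonormal frames of $N$ has a foliated $G$-reduction $B$ which admits a foliated $G$-connection without torsion. A basic $k$-form is a smooth $k$-form $\alpha$ on $M$ with $i_X\alpha=i_Xd\alpha=0$ for all $X\in T\mathcal F$; $A^k(M,\mathcal F)$ is the space of basic $k$-forms. Let $\bar *$ be the transverse Hodge star operator of $N$ (oriented by $B$), let $\delta_b=(-1)^{q(k+1)+1}\,\bar *\,(d-\kappa\wedge)\,\bar *$ on basic $k$-forms, and let $\Delta_b=\delta_b d+d\delta_b$ be the basic Laplacian. A basic form $\alpha$ is harmonic if $\Delta_b\alpha=0$. For a $G$-invariant subspace $W\subset\bigwedge^k(\mathbb R^{q})^*$, a $k$-form is of type $W$ if it is a section of the subbundle $\mathcal W=B\times_G W$ of $\bigwedge^kN^*=B\times_G\bigwedge^k(\mathbb R^q)^*$, and $P_W$ is the pointwise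 orthogonal projection of sections of $\bigwedge^kN^*$ to sections of $\mathcal W$ (for the standard scalar product of $\bigwedge^k(\mathbb R^q)^*$). Then: 1. For every $G$-invariant subspace $W\subset\bigwedge^k(\mathbb R^{q})^*$, both $P_W$ and $\Delta_b$ map $A^k(M,\mathcal F)$ to itself, and $P_W\Delta_b\alpha=\Delta_bP_W\alpha$ for all $\alpha\in A^k(M,\mathcal F)$. 2. If $W_1,\dots,W_s\subset\bigwedge^k(\mathbb R^{q})^*$ are irreducible $G$-invariant subspaces and $\alpha$ is a harmonic basic $k$-form, then $P_{W_1}\alpha,\dots,P_{W_s}\alpha$ are basic and harmonic. 3. If $W$ is a $G$-invariant subspace and $\alpha$ is a basic $k$-form of type $W$, then $\Delta_b\alpha$ is a basic $k$-form of type $W$. -/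

import Mathlib

open scoped Manifold ContDiff Topology

noncomputable section

namespace FoliatedHodge

/-! ### Linear algebra on `ℝ^q` -/

/-- Euclidean space `ℝ^q`. -/
abbrev Eucl (q : ℕ) : Type := EuclideanSpace ℝ (Fin q)

/-- The space `⋀^k (ℝ^q)^*` of alternating `k`-linear forms on `ℝ^q`. -/
abbrev Alt (q k : ℕ) : Type := Eucl q [⋀^Fin k]→L[ℝ] ℝ

/-- The orthogonal group `O(q)`: the linear operators `a` of `ℝ^q` with `aᵀ a = a aᵀ = 1`,
with the topology induced by the operator norm. -/
abbrev OrthGroup (q : ℕ) : Type := unitary (Eucl q →L[ℝ] Eucl q)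

/-- The `i`-th vector of the standard basis of `ℝ^q`. -/
abbrev stdVec {q : ℕ} (i : Fin q) : Eucl q := EuclideanSpace.single i (1 : ℝ)

/-- The Lie algebra of a subgroup `G` of `O(q)`: the operators whose one-parameter group stays
in `G`. -/
def lieAlg {q : ℕ} (G : Subgroup (OrthGroup q)) : Set (Eucl q →L[ℝ] Eucl q) :=
  {A | ∀ t : ℝ, ∃ a ∈ G, (a : Eucl q →L[ℝ] Eucl q) = NormedSpace.exp (t • A)}

/-- Invariance of a subspace of `⋀^k (ℝ^q)^*` under the standard action of `G`,
`(a · w)(v₁, …, v_k) = w (a⁻¹ v₁, …, a⁻¹ v_k)`. -/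
def IsInvariant {q k : ℕ} (G : Subgroup (OrthGroup q)) (W : Submodule ℝ (Alt q k)) : Prop :=
  ∀ a ∈ G, ∀ w ∈ W, w.compContinuousLinearMap ((a⁻¹ : OrthGroup q) : Eucl q →L[ℝ] Eucl q) ∈ W

/-- An irreducible invariant subspace: invariant, nonzero, and without proper nonzero invariant
subspaces. -/
def IsIrreducibleInvariant {q k : ℕ} (G : Subgroup (OrthGroup q))
    (W : Submodule ℝ (Alt q k)) : Prop :=
  IsInvariant G W ∧ W ≠ ⊥ ∧ ∀ W' ≤ W, IsInvariant G W' → W' = ⊥ ∨ W' = W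

/-- The standard scalar product on `⋀^k (ℝ^q)^*`,
`⟨w, w'⟩ = (1 / k!) ∑_{i₁, …, i_k} w_{i₁ … i_k} w'_{i₁ … i_k}`; the products
`e^{i₁} ∧ … ∧ e^{i_k}` with `i₁ < … < i_k` are orthonormal for it. -/
def altInner (q k : ℕ) : LinearMap.BilinForm ℝ (Alt q k) :=
  LinearMap.mk₂ ℝ
    (fun w w' => ((k.factorial : ℝ))⁻¹ *
      ∑ I : Fin k → Fin q, w (fun j => stdVec (I j)) * w' (fun j => stdVec (I j)))
    (by intro a b c; simp [add_mul, Finset.sum_add_distrib, mul_add])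
    (by intro r a c; simp only [ContinuousAlternatingMap.smul_apply, smul_eq_mul, mul_assoc,
          ← Finset.mul_sum]; ring)
    (by intro a b c; simp [Finset.sum_add_distrib, mul_add])
    (by intro r a c; simp only [ContinuousAlternatingMap.smul_apply, smul_eq_mul,
          mul_left_comm _ r, ← Finset.mul_sum])

theorem altInner_apply {q k : ℕ} (w w' : Alt q k) : altInner q k w w' =
    ((k.factorial : ℝ))⁻¹ *
      ∑ I : Fin k → Fin q, w (fun j => stdVec (I j)) * w' (fun j => stdVec (I j)) := rfl

theorem altInner_symm {q k : ℕ} (w w' : Alt q k) : altInner q k w w' = altInner q k w' w := by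
  simp only [altInner_apply, mul_comm]

theorem alt_ext {q k : ℕ} {w w' : Alt q k}
    (h : ∀ I : Fin k → Fin q, w (fun j => stdVec (I j)) = w' (fun j => stdVec (I j))) :
    w = w' := by
  apply ContinuousAlternatingMap.toAlternatingMap_injective
  apply AlternatingMap.coe_multilinearMap_injective
  refine Module.Basis.ext_multilinear (fun _ => (EuclideanSpace.basisFun (Fin q) ℝ).toBasis) ?_
  intro I
  simpa using h I

theorem altInner_self_eq_zero {q k : ℕ} {w : Alt q k} (h : altInner q k w w = 0) : w = 0 := by
  rw [altInner_apply, mul_eq_zero, or_iff_right (by positivity)] at h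
  rw [Finset.sum_eq_zero_iff_of_nonneg (fun I _ => mul_self_nonneg _)] at h
  refine alt_ext fun I => ?_
  simpa using h I (Finset.mem_univ I)

instance instFiniteDimensionalAlt (q k : ℕ) : FiniteDimensional ℝ (Alt q k) := by
  let f : Alt q k →ₗ[ℝ] ((Fin k → Fin q) → ℝ) :=
    { toFun := fun w I => w (fun j => stdVec (I j))
      map_add' := fun _ _ => rfl
      map_smul' := fun _ _ => rfl }
  exact FiniteDimensional.of_injective f fun w w' h => alt_ext fun I => congrFun h I

theorem isCompl_orthogonal {q k : ℕ} (W : Submodule ℝ (Alt q k)) :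
    IsCompl W ((altInner q k).orthogonal W) := by
  rw [LinearMap.BilinForm.isCompl_orthogonal_iff_disjoint
    (fun x y h => by rw [altInner_symm]; exact h)]
  rw [Submodule.disjoint_def]
  intro w hw hw'
  exact altInner_self_eq_zero (hw' w hw)

/-- The orthogonal projection of `⋀^k (ℝ^q)^*` onto the subspace `W`. -/
def altProj {q k : ℕ} (W : Submodule ℝ (Alt q k)) : Alt q k →ₗ[ℝ] Alt q k :=
  W.subtype ∘ₗ W.projectionOnto _ (isCompl_orthogonal W)

/-- The elementary form `e^{J₁} ∧ … ∧ e^{J_l}` on `ℝ^q`, that is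
`(v₁, …, v_l) ↦ det (e^{J_b} (v_a))`. -/
def elemForm {q l : ℕ} (J : Fin l → Fin q) : Alt q l :=
  { (Matrix.detRowAlternating (R := ℝ) (n := Fin l)).compLinearMap
      (LinearMap.pi fun b => ((EuclideanSpace.proj (𝕜 := ℝ) (J b) : Eucl q →L[ℝ] ℝ) :
        Eucl q →ₗ[ℝ] ℝ)) with
    cont := by
      refine Continuous.matrix_det (A := fun v : Fin l → Eucl q => fun a b => v a (J b)) ?_
      fun_prop }

theorem elemForm_apply {q l : ℕ} (J : Fin l → Fin q) (v : Fin l → Eucl q) :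
    elemForm J v = Matrix.det (Matrix.of fun a b => v a (J b)) := rfl

/-- The Hodge star `⋀^k (ℝ^q)^* → ⋀^l (ℝ^q)^*`, `k + l = q`, of the oriented Euclidean space
`ℝ^q`: `⋆ w = (1 / (k! l!)) ∑ ε_{i₁ … i_q} w_{i₁ … i_k} e^{i_{k+1}} ∧ … ∧ e^{i_q}`. -/
def altStar {q k l : ℕ} (h : k + l = q) : Alt q k →ₗ[ℝ] Alt q l where
  toFun w := ((k.factorial : ℝ) * (l.factorial : ℝ))⁻¹ • ∑ σ : Equiv.Perm (Fin q),
    (((Equiv.Perm.sign σ : ℤ) : ℝ) * w (fun i => stdVec (σ (Fin.cast h (Fin.castAdd l i))))) •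
      elemForm (fun j => σ (Fin.cast h (Fin.natAdd k j)))
  map_add' w w' := by
    simp only [ContinuousAlternatingMap.add_apply, mul_add, add_smul, Finset.sum_add_distrib,
      smul_add]
  map_smul' r w := by
    simp only [ContinuousAlternatingMap.smul_apply, smul_eq_mul, RingHom.id_apply,
      Finset.smul_sum, smul_smul]
    refine Finset.sum_congr rfl fun σ _ => ?_
    congr 1
    ring

/-- The exterior product `κ ∧ w` of a linear form and an alternating form,
`(κ ∧ w)(v₀, …, v_k) = ∑ᵢ (-1)ⁱ κ(vᵢ) w(v₀, …, v̂ᵢ, …, v_k)`. -/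
def wedgeOne {E : Type*} [NormedAddCommGroup E] [NormedSpace ℝ E] {k : ℕ} (κ : E →L[ℝ] ℝ)
    (w : E [⋀^Fin k]→L[ℝ] ℝ) : E [⋀^Fin (k + 1)]→L[ℝ] ℝ :=
  ContinuousAlternatingMap.alternatizeUncurryFin (κ.smulRight w)

/-! ### Differential forms on manifolds -/

section Forms

variable (E : Type*) [NormedAddCommGroup E] [NormedSpace ℝ E]
  (M : Type*) [TopologicalSpace M] [ChartedSpace E M]

/-- Fields of alternating `k`-linear forms on the tangent spaces of `M`, with values in `V`;
smoothness is a separate predicate. -/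
abbrev Form (V : Type*) [NormedAddCommGroup V] [NormedSpace ℝ V] (k : ℕ) : Type _ :=
  (x : M) → TangentSpace 𝓘(ℝ, E) x [⋀^Fin k]→L[ℝ] V

/-- Fields of linear maps from the tangent spaces of `M` to `V`. -/
abbrev LinForm (V : Type*) [NormedAddCommGroup V] [NormedSpace ℝ V] : Type _ :=
  (x : M) → TangentSpace 𝓘(ℝ, E) x →L[ℝ] V

variable {E M} {V : Type*} [NormedAddCommGroup V] [NormedSpace ℝ V] {k : ℕ}

/-- A field of linear maps, seen as a form of degree one. -/
def LinForm.toForm (θ : LinForm E M V) : Form E M V 1 := fun x =>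
  ContinuousAlternatingMap.ofSubsingleton ℝ (TangentSpace 𝓘(ℝ, E) x) V (0 : Fin 1) (θ x)

/-- The expression of a form in the chart around `x₀`, that is its pull-back by the inverse of
the chart; it is meaningful on the target of the chart. -/
def Form.inChart (α : Form E M V k) (x₀ : M) (y : E) : E [⋀^Fin k]→L[ℝ] V :=
  (α ((extChartAt 𝓘(ℝ, E) x₀).symm y)).compContinuousLinearMap
    ((mfderiv 𝓘(ℝ, E) 𝓘(ℝ, E) (extChartAt 𝓘(ℝ, E) x₀).symm y).comp
      ((NormedSpace.fromTangentSpace (𝕜 := ℝ) y).symm : E →L[ℝ] TangentSpace 𝓘(ℝ, E) y))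

/-- A form is smooth on the open set `U` if its expressions in all charts are. -/
def Form.SmoothOn (α : Form E M V k) (U : Set M) : Prop :=
  ∀ x₀ : M, ContDiffOn ℝ ∞ (α.inChart x₀)
    ((extChartAt 𝓘(ℝ, E) x₀).target ∩ (extChartAt 𝓘(ℝ, E) x₀).symm ⁻¹' U)

/-- The exterior derivative, computed at `x` in the chart around `x`. -/
def Form.d (α : Form E M V k) : Form E M V (k + 1) := fun x =>
  (extDeriv (α.inChart x) (extChartAt 𝓘(ℝ, E) x x)).compContinuousLinearMap
    (((NormedSpace.fromTangentSpace (𝕜 := ℝ) (extChartAt 𝓘(ℝ, E) x x)) :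
        TangentSpace 𝓘(ℝ, E) (extChartAt 𝓘(ℝ, E) x x) →L[ℝ] E).comp
      (mfderiv 𝓘(ℝ, E) 𝓘(ℝ, E) (extChartAt 𝓘(ℝ, E) x) x))

/-- The exterior product `κ ∧ α` with a form of degree one. -/
def Form.wedgeLin (κ : LinForm E M ℝ) (α : Form E M ℝ k) : Form E M ℝ (k + 1) := fun x =>
  wedgeOne (E := E) (k := k) (κ x) (α x)

end Forms

/-! ### Foliations, basic forms, bundle-like metrics -/

section Foliations

variable {E : Type*} [NormedAddCommGroup E] [NormedSpace ℝ E]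
  {M : Type*} [TopologicalSpace M] [ChartedSpace E M]

/-- A smooth foliation of codimension `q` of `M`, given by the subspaces `T_xF ⊆ T_xM` tangent to
the leaves: locally these are the kernels of the differential of a submersion to `ℝ^q`. -/
structure Foliation (E : Type*) [NormedAddCommGroup E] [NormedSpace ℝ E]
    (M : Type*) [TopologicalSpace M] [ChartedSpace E M] (q : ℕ) where
  tangent : (x : M) → Submodule ℝ (TangentSpace 𝓘(ℝ, E) x)
  exists_submersion : ∀ x : M, ∃ U : Set M, IsOpen U ∧ x ∈ U ∧ ∃ f : M → Eucl q,
    ContMDiffOn 𝓘(ℝ, E) 𝓘(ℝ, Eucl q) ∞ f U ∧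
    ∀ y ∈ U, Function.Surjective (mfderiv 𝓘(ℝ, E) 𝓘(ℝ, Eucl q) f y) ∧
      (mfderiv 𝓘(ℝ, E) 𝓘(ℝ, Eucl q) f y).ker = tangent y

variable {q : ℕ} {V : Type*} [NormedAddCommGroup V] [NormedSpace ℝ V] {k : ℕ}

/-- The interior product of the form with every vector tangent to the leaves vanishes at `x`. -/
def Foliation.Kills (F : Foliation E M q) (α : Form E M V k) (x : M) : Prop :=
  ∀ v : Fin k → TangentSpace 𝓘(ℝ, E) x, (∃ i, v i ∈ F.tangent x) → α x v = 0

/-- Basic forms on the open set `U`: smooth forms `α` with `i_X α = i_X dα = 0` for all `X`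
tangent to the leaves. -/
def Foliation.IsBasicOn (F : Foliation E M q) (α : Form E M V k) (U : Set M) : Prop :=
  α.SmoothOn U ∧ ∀ x ∈ U, F.Kills α x ∧ F.Kills α.d x

/-- Basic forms on `M`. -/
def Foliation.IsBasic (F : Foliation E M q) (α : Form E M V k) : Prop :=
  F.IsBasicOn α Set.univ

variable [IsManifold 𝓘(ℝ, E) ∞ M]

/-- Smooth Riemannian metrics on `M`. -/
abbrev Metric (E : Type*) [NormedAddCommGroup E] [NormedSpace ℝ E]
    (M : Type*) [TopologicalSpace M] [ChartedSpace E M] [IsManifold 𝓘(ℝ, E) ∞ M] : Type _ :=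
  Bundle.ContMDiffRiemannianMetric 𝓘(ℝ, E) ∞ E (fun x : M => TangentSpace 𝓘(ℝ, E) x)

/-- The vector `v` is orthogonal to the leaf through `x`. -/
def Foliation.IsNormal (F : Foliation E M q) (g : Metric E M) {x : M}
    (v : TangentSpace 𝓘(ℝ, E) x) : Prop :=
  ∀ w ∈ F.tangent x, g.inner x v w = 0

/-- The metric `g` is bundle-like for `F` (so that `F` is a Riemannian foliation): locally, `F` is
defined by a Riemannian submersion onto an open subset of `ℝ^q` with some Riemannian metric `h`. -/
def Foliation.IsBundleLike (F : Foliation E M q) (g : Metric E M) : Prop :=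
  ∀ x : M, ∃ U : Set M, IsOpen U ∧ x ∈ U ∧ ∃ f : M → Eucl q,
    ContMDiffOn 𝓘(ℝ, E) 𝓘(ℝ, Eucl q) ∞ f U ∧
    (∀ y ∈ U, Function.Surjective (mfderiv 𝓘(ℝ, E) 𝓘(ℝ, Eucl q) f y) ∧
      (mfderiv 𝓘(ℝ, E) 𝓘(ℝ, Eucl q) f y).ker = F.tangent y) ∧
    ∃ h : Eucl q → Eucl q →L[ℝ] Eucl q →L[ℝ] ℝ, ContDiffOn ℝ ∞ h (f '' U) ∧
      ∀ y ∈ U, ∀ v w : TangentSpace 𝓘(ℝ, E) y, F.IsNormal g v → F.IsNormal g w →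
        g.inner y v w =
          h (f y)
            (NormedSpace.fromTangentSpace (f y) (mfderiv 𝓘(ℝ, E) 𝓘(ℝ, Eucl q) f y v))
            (NormedSpace.fromTangentSpace (f y) (mfderiv 𝓘(ℝ, E) 𝓘(ℝ, Eucl q) f y w))

/-- Smoothness of a vector field on the open set `U`. -/
def SmoothField (X : (x : M) → TangentSpace 𝓘(ℝ, E) x) (U : Set M) : Prop :=
  ContMDiffOn 𝓘(ℝ, E) 𝓘(ℝ, E).tangent ∞
    (fun x => (⟨x, X x⟩ : TangentBundle 𝓘(ℝ, E) M)) U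

/-- The characterization of the mean curvature form `κ` of the leaves: `κ` vanishes on vectors
tangent to the leaves, and `κ(Y) = g (∑ᵢ ∇_{Eᵢ} Eᵢ, Y)` for `Y` normal to the leaves, where `∇` is
the Levi-Civita connection of `g` and `E₁, …, E_p` is a local orthonormal frame of the tangent
bundle of the leaves. By the Koszul formula, `g (∇_{Eᵢ} Eᵢ, Y) = g ([Y, Eᵢ], Eᵢ)`. -/
def Foliation.IsMeanCurvatureForm (F : Foliation E M q) (g : Metric E M)
    (κ : LinForm E M ℝ) : Prop :=
  (∀ x, ∀ v ∈ F.tangent x, κ x v = 0) ∧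
  ∀ (U : Set M), IsOpen U → ∀ (p : ℕ) (X : Fin p → (x : M) → TangentSpace 𝓘(ℝ, E) x)
    (Y : (x : M) → TangentSpace 𝓘(ℝ, E) x),
    (∀ i, SmoothField (X i) U) → SmoothField Y U →
    (∀ x ∈ U, Submodule.span ℝ (Set.range fun i => X i x) = F.tangent x ∧
      (∀ i j, g.inner x (X i x) (X j x) = if i = j then 1 else 0) ∧ F.IsNormal g (Y x)) →
    ∀ x ∈ U, κ x (Y x) =
      ∑ i, g.inner x (VectorField.mlieBracket 𝓘(ℝ, E) Y (X i) x) (X i x)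

/-- The mean curvature form `κ` of the leaves: the form singled out by
`Foliation.IsMeanCurvatureForm`. -/
def Foliation.meanCurvatureForm (F : Foliation E M q) (g : Metric E M) : LinForm E M ℝ :=
  Classical.epsilon (F.IsMeanCurvatureForm g)

/-- All leaves are minimal submanifolds of `(M, g)`. -/
def Foliation.HasMinimalLeaves (F : Foliation E M q) (g : Metric E M) : Prop :=
  F.meanCurvatureForm g = 0

end Foliations

/-! ### Foliated reductions of the normal frame bundle -/

section Reductions

variable {E : Type*} [NormedAddCommGroup E] [NormedSpace ℝ E]
  {M : Type*} [TopologicalSpace M] [ChartedSpace E M] {q : ℕ}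

/-- A foliated `G`-reduction `B` of the frame bundle of the normal bundle `N = TM / TF`.
A frame `u : ℝ^q ≃ N_x` is recorded by `u⁻¹ ∘ π_N : T_xM → ℝ^q` (the value at `u` of the canonical
form), a linear map onto `ℝ^q` with kernel `T_xF`; the frame `u ∘ a⁻¹` is then recorded by
`a ∘ u⁻¹ ∘ π_N`. The fibres of `B` are orbits of `G`, and around each point `B` has a smooth
section which is foliated, i.e. constant along the leaves: the `ℝ^q`-valued form that records
it is basic. -/
structure FoliatedReduction (F : Foliation E M q) (G : Subgroup (OrthGroup q)) where
  coframes : (x : M) → Set (TangentSpace 𝓘(ℝ, E) x →L[ℝ] Eucl q)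
  surjective : ∀ x, ∀ θ ∈ coframes x, Function.Surjective θ
  ker_eq : ∀ x, ∀ θ ∈ coframes x, θ.ker = F.tangent x
  smul_mem : ∀ x, ∀ θ ∈ coframes x, ∀ a ∈ G,
    (a : Eucl q →L[ℝ] Eucl q).comp θ ∈ coframes x
  exists_smul : ∀ x, ∀ θ ∈ coframes x, ∀ θ' ∈ coframes x, ∃ a ∈ G,
    θ' = (a : Eucl q →L[ℝ] Eucl q).comp θ
  exists_section : ∀ x : M, ∃ U : Set M, IsOpen U ∧ x ∈ U ∧ ∃ θ : LinForm E M (Eucl q),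
    F.IsBasicOn θ.toForm U ∧ ∀ y ∈ U, θ y ∈ coframes y

namespace FoliatedReduction

variable {F : Foliation E M q} {G : Subgroup (OrthGroup q)}

/-- The fibres of a reduction are nonempty. -/
theorem nonempty (B : FoliatedReduction F G) (x : M) : ∃ θ, θ ∈ B.coframes x := by
  obtain ⟨U, -, hx, θ, -, h⟩ := B.exists_section x
  exact ⟨θ x, h x hx⟩

/-- Smooth sections of `B` on the open set `U`. -/
def IsSectionOn (B : FoliatedReduction F G) (θ : LinForm E M (Eucl q)) (U : Set M) : Prop :=
  θ.toForm.SmoothOn U ∧ ∀ y ∈ U, θ y ∈ B.coframes y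

/-- The frames of `B` are orthonormal for the metric which `g` induces on the normal bundle,
identified with the orthogonal complement of `TF`. -/
def IsOrthonormal [IsManifold 𝓘(ℝ, E) ∞ M] (B : FoliatedReduction F G) (g : Metric E M) : Prop :=
  ∀ x, ∀ θ ∈ B.coframes x, ∀ v w : TangentSpace 𝓘(ℝ, E) x, F.IsNormal g v → F.IsNormal g w →
    g.inner x v w = inner ℝ (θ v) (θ w)

/-- A frame of `B` at `x` (any one; the constructions below do not depend on it). -/
def coframe (B : FoliatedReduction F G) (x : M) : TangentSpace 𝓘(ℝ, E) x →L[ℝ] Eucl q :=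
  Classical.choose (B.nonempty x)

theorem coframe_mem (B : FoliatedReduction F G) (x : M) : B.coframe x ∈ B.coframes x :=
  Classical.choose_spec (B.nonempty x)

/-- A right inverse of the chosen `u⁻¹ ∘ π_N : T_xM → ℝ^q`, that is, a lift to `T_xM` of the
frame `u : ℝ^q → N_x`. -/
def lift (B : FoliatedReduction F G) (x : M) : Eucl q →L[ℝ] TangentSpace 𝓘(ℝ, E) x :=
  Classical.choose ((B.coframe x).exists_rightInverse_of_surjective
    (LinearMap.range_eq_top.2 (B.surjective x _ (B.coframe_mem x))))

theorem coframe_comp_lift (B : FoliatedReduction F G) (x : M) :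
    (B.coframe x).comp (B.lift x) = ContinuousLinearMap.id ℝ (Eucl q) :=
  Classical.choose_spec ((B.coframe x).exists_rightInverse_of_surjective
    (LinearMap.range_eq_top.2 (B.surjective x _ (B.coframe_mem x))))

/-- The operator on sections of `⋀ N^*` (the forms which vanish on vectors tangent to the leaves)
that is given in frames of `B`, point by point, by the `G`-equivariant operator `T`. -/
def fibrewise {k l : ℕ} (B : FoliatedReduction F G) (T : Alt q k →ₗ[ℝ] Alt q l)
    (α : Form E M ℝ k) : Form E M ℝ l := fun x =>
  (T ((α x).compContinuousLinearMap (B.lift x))).compContinuousLinearMap (B.coframe x)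

/-- The projection `P_W` of `k`-forms on the normal bundle to forms of type `W`. -/
def proj {k : ℕ} (B : FoliatedReduction F G) (W : Submodule ℝ (Alt q k))
    (α : Form E M ℝ k) : Form E M ℝ k :=
  B.fibrewise (altProj W) α

/-- The form `α` is of type `W`: it is a section of the bundle with fibre `W` associated with
`B`. -/
def IsOfType {k : ℕ} (B : FoliatedReduction F G) (W : Submodule ℝ (Alt q k))
    (α : Form E M ℝ k) : Prop :=
  ∀ x, ∀ θ ∈ B.coframes x, ∃ w ∈ W, α x = w.compContinuousLinearMap θ

/-- The transverse Hodge star `⋆̄` from forms of degree `k` to forms of degree `l = q - k`; for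
connected `G` the frames of `B` orient the normal bundle. -/
def star {k l : ℕ} (B : FoliatedReduction F G) (h : k + l = q) (α : Form E M ℝ k) :
    Form E M ℝ l :=
  B.fibrewise (altStar h) α

/-- The codifferential `δ_b = (-1)^{q(k+1)+1} ⋆̄ (d - κ ∧) ⋆̄` on basic forms of degree `k`,
written here for the degree `k + 1`. In degrees above `q` all basic forms vanish. -/
def codiff {k : ℕ} (B : FoliatedReduction F G) (κ : LinForm E M ℝ) (α : Form E M ℝ (k + 1)) :
    Form E M ℝ k :=
  if h : k + 1 ≤ q then
    let β : Form E M ℝ (q - (k + 1)) := B.star (Nat.add_sub_cancel' h) α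
    (-1 : ℝ) ^ (q * (k + 1 + 1) + 1) •
      B.star (show q - (k + 1) + 1 + k = q by omega) (β.d - β.wedgeLin κ)
  else 0

/-- The basic Laplacian `Δ_b = δ_b d + d δ_b`. -/
def laplacian (B : FoliatedReduction F G) (κ : LinForm E M ℝ) :
    {k : ℕ} → Form E M ℝ k → Form E M ℝ k
  | 0, α => B.codiff κ α.d
  | _ + 1, α => B.codiff κ α.d + (B.codiff κ α).d

/-- A foliated connection in the `G`-bundle `B`. It is given by its connection forms: a smooth
local section `θ` of `B` on `U` has a connection form `ω_θ` on `U`, with values in the Lie algebra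
of `G`. If `a : U → G` is smooth then `ω_{aθ} = a ω_θ a⁻¹ - da a⁻¹`. The connection is foliated:
foliated sections have basic connection forms. -/
structure FoliatedConnection (B : FoliatedReduction F G) where
  form : LinForm E M (Eucl q) → LinForm E M (Eucl q →L[ℝ] Eucl q)
  smoothOn : ∀ U : Set M, IsOpen U → ∀ θ, B.IsSectionOn θ U → (form θ).toForm.SmoothOn U
  mem_lieAlg : ∀ U : Set M, IsOpen U → ∀ θ, B.IsSectionOn θ U →
    ∀ x ∈ U, ∀ v, form θ x v ∈ lieAlg G
  form_smul : ∀ U : Set M, IsOpen U → ∀ θ θ', B.IsSectionOn θ U → B.IsSectionOn θ' U →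
    ∀ a : M → OrthGroup q,
      ContMDiffOn 𝓘(ℝ, E) 𝓘(ℝ, Eucl q →L[ℝ] Eucl q) ∞
        (fun x => (a x : Eucl q →L[ℝ] Eucl q)) U →
      (∀ x ∈ U, a x ∈ G ∧ θ' x = (a x : Eucl q →L[ℝ] Eucl q).comp (θ x)) →
      ∀ x ∈ U, ∀ v : TangentSpace 𝓘(ℝ, E) x,
        form θ' x v =
          (a x : Eucl q →L[ℝ] Eucl q) * form θ x v *
              (((a x)⁻¹ : OrthGroup q) : Eucl q →L[ℝ] Eucl q) -
            (NormedSpace.fromTangentSpace (a x : Eucl q →L[ℝ] Eucl q)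
              (mfderiv 𝓘(ℝ, E) 𝓘(ℝ, Eucl q →L[ℝ] Eucl q)
                (fun y => (a y : Eucl q →L[ℝ] Eucl q)) x v)) *
              (((a x)⁻¹ : OrthGroup q) : Eucl q →L[ℝ] Eucl q)
  foliated : ∀ U : Set M, IsOpen U → ∀ θ, B.IsSectionOn θ U → F.IsBasicOn θ.toForm U →
    F.IsBasicOn (form θ).toForm U

/-- The torsion vanishes: `dθ = - ω_θ ∧ θ` for all smooth local sections `θ` of `B`. -/
def FoliatedConnection.IsTorsionFree {B : FoliatedReduction F G} (D : B.FoliatedConnection) :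
    Prop :=
  ∀ U : Set M, IsOpen U → ∀ θ, B.IsSectionOn θ U → ∀ x ∈ U,
    ∀ v w : TangentSpace 𝓘(ℝ, E) x,
      θ.toForm.d x ![v, w] = - (D.form θ x v (θ x w) - D.form θ x w (θ x v))

end FoliatedReduction

end Reductions

end FoliatedHodge

end

/-! The argument is local and rests on a Weitzenböck formula. In a foliated local section of `B`, a
basic form is a function `A` with values in `Alt q k` that is constant along the leaves, and the
connection form is `Ω ∘ θ` with `Ω` constant along the leaves and with values in the Lie algebra of
`G` (`exists_isFrame`, `exists_hasCoeff`). Elements of this Lie algebra are skew, so the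
torsion-free connection is the transverse Levi-Civita connection.

Absence of torsion makes `d` the alternation of the covariant derivative `∇`
(`IsBasicFun.extDeriv_coframe_comp`). A connected `G` lies in `SO(q)`, so the star is equivariant
and therefore parallel; with `κ = 0` this gives `δ_b = -div ∇` (`altStar_extDerivCoeff_altStar`).
Combining both with the Ricci identity yields `Δ_b A = -(tr ∇²A + ∑ E_ij · R(e_i, e_j) · A)`, where
`E_ij` acts by `e^j ∧ ι_{e_i}` (`weitzenboeck`, `laplacian_succ`).

The projection `P_W` is `G`-equivariant, so it commutes with the action of the Lie algebra, hence
with `∇`, with `tr ∇²` and with every curvature operator. The operators `E_ij` alone need not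
commute with `P_W`. However, the first Bianchi identity and skewness give the pair symmetry of `R`,
so `∑ E_ij ⊗ R(e_i, e_j)` is a symmetric tensor and its first factor can also be made to run through
curvature operators (`curvatureTerm_comm`). Thus `P_W` commutes with `Δ_b` (`laplacian_map`).

The other two claims are formal: `Δ_b P_W α = P_W Δ_b α = 0` for harmonic `α`, and a form of type
`W` is one that `P_W` fixes. -/

noncomputable section

namespace FoliatedHodge

open ContinuousAlternatingMap (fderivCompContinuousLinearMapCLM fderivCompContinuousLinearMap_apply
  curryLeft_apply_apply alternatizeUncurryFin alternatizeUncurryFinCLM alternatizeUncurryFin_apply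
  alternatizeUncurryFinCLM_apply fderivCompContinuousLinearMap_eq_alternatizeUncurryFin curryLeftLI
  compContinuousLinearMap_apply compContinuousLinearMapCLM)

/-! ### The infinitesimal action of operators on alternating forms -/

section InfinitesimalAction

variable {q k : ℕ}

/-- The derivation of forms induced by the operator `X`:
`(X · w)(v₁, …, v_k) = ∑ᵢ w (v₁, …, X vᵢ, …, v_k)`. -/
def infAct : (Eucl q →L[ℝ] Eucl q) →L[ℝ] Alt q k →L[ℝ] Alt q k :=
  (fderivCompContinuousLinearMapCLM ℝ (ContinuousLinearMap.id ℝ (Eucl q))).flip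

theorem infAct_eq (X : Eucl q →L[ℝ] Eucl q) (w : Alt q k) :
    infAct X w = w.fderivCompContinuousLinearMap (ContinuousLinearMap.id ℝ (Eucl q)) X := rfl

theorem infAct_apply (X : Eucl q →L[ℝ] Eucl q) (w : Alt q k) (v : Fin k → Eucl q) :
    infAct X w v = ∑ i, w (Function.update v i (X (v i))) := by
  rw [infAct_eq, fderivCompContinuousLinearMap_apply]
  refine Finset.sum_congr rfl fun i _ => congrArg w (funext fun j => ?_)
  by_cases h : j = i
  · subst h; simp
  · simp [h]

theorem infAct_degree_zero (X : Eucl q →L[ℝ] Eucl q) (w : Alt q 0) : infAct X w = 0 := by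
  ext v
  simp [infAct_apply]

theorem alt_ext_curryLeft {w w' : Alt q (k + 1)} (h : ∀ a, w.curryLeft a = w'.curryLeft a) :
    w = w' := by
  ext v
  have := congrArg (fun f : Alt q k => f (Fin.tail v)) (h (v 0))
  simpa [Matrix.vecCons, Fin.cons_self_tail] using this

theorem curryLeft_infAct (X : Eucl q →L[ℝ] Eucl q) (w : Alt q (k + 1)) (a : Eucl q) :
    (infAct X w).curryLeft a = infAct X (w.curryLeft a) + w.curryLeft (X a) := by
  ext v
  simp only [curryLeft_apply_apply, infAct_apply, ContinuousAlternatingMap.add_apply,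
    Fin.sum_univ_succ]
  rw [add_comm]
  congr 1
  · refine Finset.sum_congr rfl fun i _ => ?_
    congr 1
    simp [Matrix.vecCons]
  · congr 1
    simp [Matrix.vecCons]

/-- Pull-back is a right action, so its differential reverses brackets. Contracting with a vector
lowers the degree, which allows an induction. -/
theorem infAct_commutator (X Y : Eucl q →L[ℝ] Eucl q) (w : Alt q k) :
    infAct X (infAct Y w) - infAct Y (infAct X w) = infAct (Y * X - X * Y) w := by
  induction k with
  | zero => simp [infAct_degree_zero]
  | succ k ih =>
    refine alt_ext_curryLeft fun a => ?_
    have h := ih (w.curryLeft a)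
    have hsub : (infAct X (infAct Y w) - infAct Y (infAct X w)).curryLeft a =
        (infAct X (infAct Y w)).curryLeft a - (infAct Y (infAct X w)).curryLeft a := rfl
    rw [hsub]
    simp only [curryLeft_infAct, map_add] at h ⊢
    rw [← h]
    simp only [sub_apply, mul_apply_eq_comp, map_sub]
    abel

/-- A derivation acts on every argument of the alternated form, the argument fed to `Φ` included;
the second summand accounts for the latter. -/
theorem infAct_alternatizeUncurryFin (X : Eucl q →L[ℝ] Eucl q) (Φ : Eucl q →L[ℝ] Alt q k) :
    infAct X (alternatizeUncurryFin Φ) =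
      alternatizeUncurryFin ((infAct X).comp Φ + Φ.comp X) := by
  ext v
  simp only [infAct_apply, alternatizeUncurryFin_apply]
  rw [Finset.sum_comm]
  refine Finset.sum_congr rfl fun i _ => ?_
  rw [Fin.sum_univ_succAbove _ i, ← Finset.smul_sum, ← smul_add]
  congr 1
  simp only [add_apply, ContinuousLinearMap.comp_apply,
    ContinuousAlternatingMap.add_apply, infAct_apply]
  rw [add_comm]
  congr 1
  · refine Finset.sum_congr rfl fun j _ => ?_
    simp [Fin.removeNth_apply]
  · simp

theorem infAct_eq_alternatizeUncurryFin (X : Eucl q →L[ℝ] Eucl q) (w : Alt q (k + 1)) :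
    infAct X w = alternatizeUncurryFin (w.curryLeft.comp X) := by
  rw [infAct_eq, fderivCompContinuousLinearMap_eq_alternatizeUncurryFin]
  rfl

/-- This turns a derivative `X ∘ θ` of the coframe into an action on the coefficients; it is how the
connection enters `d`. -/
theorem fderivCompContinuousLinearMap_comp {E : Type*} [NormedAddCommGroup E] [NormedSpace ℝ E]
    (w : Alt q k) (θ : E →L[ℝ] Eucl q) (X : Eucl q →L[ℝ] Eucl q) :
    w.fderivCompContinuousLinearMap θ (X.comp θ) = (infAct X w).compContinuousLinearMap θ := by
  ext v
  simp only [fderivCompContinuousLinearMap_apply, compContinuousLinearMap_apply, infAct_apply]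
  refine Finset.sum_congr rfl fun i _ => congrArg w (funext fun j => ?_)
  by_cases h : j = i
  · subst h; simp
  · simp [h]

theorem curryLeft_alternatizeUncurryFin_zero (Φ : Eucl q →L[ℝ] Alt q 0) (a : Eucl q) :
    (alternatizeUncurryFin Φ).curryLeft a = Φ a := by
  ext v
  simp only [curryLeft_apply_apply, alternatizeUncurryFin_apply, Fin.sum_univ_succ]
  simp [Matrix.vecCons]

/-- The interior product `ι_a w = w (a, …)`. -/
def interior : Eucl q →L[ℝ] Alt q (k + 1) →L[ℝ] Alt q k :=
  (curryLeftLI (𝕜 := ℝ) (E := Eucl q) (F := ℝ)).toContinuousLinearMap.flip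

theorem interior_apply (a : Eucl q) (w : Alt q (k + 1)) : interior a w = w.curryLeft a := rfl

theorem interior_infAct (X : Eucl q →L[ℝ] Eucl q) (w : Alt q (k + 1)) (a : Eucl q) :
    interior a (infAct X w) = infAct X (interior a w) + interior (X a) w :=
  curryLeft_infAct X w a

theorem interior_alternatizeUncurryFin_zero (Φ : Eucl q →L[ℝ] Alt q 0) (a : Eucl q) :
    interior a (alternatizeUncurryFin Φ) = Φ a :=
  curryLeft_alternatizeUncurryFin_zero Φ a

/-- Interior product is an antiderivation for exterior multiplication by covectors. This sign is
what makes the cross terms of `δd` and `dδ` cancel in the Weitzenböck formula. -/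
theorem interior_alternatizeUncurryFin (Φ : Eucl q →L[ℝ] Alt q (k + 1)) (a : Eucl q) :
    interior a (alternatizeUncurryFin Φ) =
      Φ a - alternatizeUncurryFin ((interior a).comp Φ) := by
  ext v
  simp only [interior_apply, curryLeft_apply_apply, alternatizeUncurryFin_apply,
    ContinuousAlternatingMap.sub_apply, ContinuousLinearMap.comp_apply]
  rw [Fin.sum_univ_succ, sub_eq_add_neg, ← Finset.sum_neg_distrib]
  congr 1
  · simp [Matrix.vecCons]
  · refine Finset.sum_congr rfl fun i _ => ?_
    have h : i.succ.removeNth (Matrix.vecCons a v) = Matrix.vecCons a (i.removeNth v) := by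
      funext j
      refine Fin.cases ?_ (fun j => ?_) j
      · simp [Fin.removeNth_apply]
      · simp [Fin.removeNth_apply]
    rw [h]
    simp [pow_succ]

theorem alternatizeUncurryFin_sub {E : Type*} [NormedAddCommGroup E] [NormedSpace ℝ E]
    {V : Type*} [NormedAddCommGroup V] [NormedSpace ℝ V] (Φ Ψ : E →L[ℝ] E [⋀^Fin k]→L[ℝ] V) :
    alternatizeUncurryFin (Φ - Ψ) = alternatizeUncurryFin Φ - alternatizeUncurryFin Ψ :=
  map_sub (alternatizeUncurryFinCLM ℝ E V) Φ Ψ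

/-- The contraction `∑ᵢ ι_{eᵢ} Φ(eᵢ)`. -/
def divergence : (Eucl q →L[ℝ] Alt q (k + 1)) →L[ℝ] Alt q k :=
  ∑ i, (interior (stdVec i)).comp (ContinuousLinearMap.apply ℝ (Alt q (k + 1)) (stdVec i))

theorem divergence_apply (Φ : Eucl q →L[ℝ] Alt q (k + 1)) :
    divergence Φ = ∑ i, interior (stdVec i) (Φ (stdVec i)) := by
  simp [divergence]

theorem sum_inner_stdVec (v : Eucl q) : ∑ i, inner ℝ (stdVec i) v • stdVec i = v := by
  simpa using (EuclideanSpace.basisFun (Fin q) ℝ).sum_repr' v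

/-- The operator `X` is skew-symmetric. -/
def IsSkew (X : Eucl q →L[ℝ] Eucl q) : Prop := ∀ u v, inner ℝ (X u) v = -inner ℝ u (X v)

/-- A skew operator annihilates the metric tensor `∑ eᵢ ⊗ eᵢ`, hence its image under any bilinear
map. -/
theorem IsSkew.sum_bilin_eq_zero {X : Eucl q →L[ℝ] Eucl q} (hX : IsSkew X) {H : Type*}
    [AddCommGroup H] [Module ℝ H] (f : Eucl q →ₗ[ℝ] Eucl q →ₗ[ℝ] H) :
    ∑ i, (f (X (stdVec i)) (stdVec i) + f (stdVec i) (X (stdVec i))) = 0 := by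
  have h1 : ∀ i : Fin q, f (X (stdVec i)) (stdVec i) =
      ∑ j, inner ℝ (stdVec j) (X (stdVec i)) • f (stdVec j) (stdVec i) := fun i => by
    conv_lhs => rw [← sum_inner_stdVec (X (stdVec i))]
    simp only [map_sum, map_smul, LinearMap.sum_apply, LinearMap.smul_apply]
  have h2 : ∀ i : Fin q, f (stdVec i) (X (stdVec i)) =
      ∑ j, inner ℝ (stdVec j) (X (stdVec i)) • f (stdVec i) (stdVec j) := fun i => by
    conv_lhs => rw [← sum_inner_stdVec (X (stdVec i))]
    simp only [map_sum, map_smul]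
  rw [Finset.sum_add_distrib]
  simp only [h1, h2]
  rw [Finset.sum_comm, ← Finset.sum_add_distrib]
  refine Finset.sum_eq_zero fun i _ => ?_
  rw [← Finset.sum_add_distrib]
  refine Finset.sum_eq_zero fun j _ => ?_
  rw [← add_smul, real_inner_comm, hX, neg_add_cancel, zero_smul]

/-- The divergence contracts with the metric, so it commutes with operators that preserve the metric
infinitesimally; the two defects cancel by skewness. -/
theorem infAct_divergence {X : Eucl q →L[ℝ] Eucl q} (hX : IsSkew X)
    (Φ : Eucl q →L[ℝ] Alt q (k + 1)) :
    infAct X (divergence Φ) = divergence ((infAct X).comp Φ + Φ.comp X) := by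
  let f : Eucl q →ₗ[ℝ] Eucl q →ₗ[ℝ] Alt q k :=
    LinearMap.mk₂ ℝ (fun a b => interior a (Φ b)) (by simp) (by simp) (by simp) (by simp)
  have h := hX.sum_bilin_eq_zero f
  simp only [f, LinearMap.mk₂_apply, Finset.sum_add_distrib] at h
  simp only [divergence_apply, map_sum, ContinuousLinearMap.comp_apply,
    map_add, Finset.sum_add_distrib, interior_infAct]
  rw [add_assoc, h, add_zero]

/-- Here `Q` stands for a second covariant derivative. By the antiderivation rule, `δd` contributes
the trace and a cross term, and `dδ` the same cross term with the arguments of `Q` exchanged, so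
only the antisymmetric part of `Q` survives beside the trace. -/
theorem weitzenboeck_algebra (Q : Eucl q →L[ℝ] Eucl q →L[ℝ] Alt q (k + 1)) :
    divergence ((alternatizeUncurryFinCLM ℝ (Eucl q) ℝ).comp Q) +
        alternatizeUncurryFin (divergence.comp Q) =
      ∑ i, Q (stdVec i) (stdVec i) +
        ∑ i, alternatizeUncurryFin ((interior (stdVec i)).comp (Q.flip (stdVec i) - Q (stdVec i)))
    := by
  have h : alternatizeUncurryFin (divergence.comp Q) =
      ∑ i, alternatizeUncurryFin ((interior (stdVec i)).comp (Q.flip (stdVec i))) := by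
    simp only [← alternatizeUncurryFinCLM_apply, ← map_sum]
    congr 1
    ext a : 1
    simp [divergence_apply]
  rw [h, divergence_apply, ← Finset.sum_add_distrib, ← Finset.sum_add_distrib]
  refine Finset.sum_congr rfl fun i _ => ?_
  rw [ContinuousLinearMap.comp_sub, alternatizeUncurryFin_sub]
  simp only [ContinuousLinearMap.comp_apply, alternatizeUncurryFinCLM_apply,
    interior_alternatizeUncurryFin]
  abel

/-- The operator of rank one `v ↦ v_j e_i`. -/
def elemOp (i j : Fin q) : Eucl q →L[ℝ] Eucl q :=
  (EuclideanSpace.proj (𝕜 := ℝ) j : Eucl q →L[ℝ] ℝ).smulRight (stdVec i)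

theorem sum_elemOp (X : Eucl q →L[ℝ] Eucl q) :
    ∑ i, ∑ j, inner ℝ (stdVec i) (X (stdVec j)) • elemOp i j = X := by
  ext v : 1
  conv_rhs => rw [← sum_inner_stdVec v, map_sum]
  simp only [sum_apply, smul_apply, elemOp, ContinuousLinearMap.smulRight_apply, map_smul]
  rw [Finset.sum_comm]
  refine Finset.sum_congr rfl fun j _ => ?_
  conv_rhs => rw [← sum_inner_stdVec (X (stdVec j)), Finset.smul_sum]
  refine Finset.sum_congr rfl fun i _ => ?_
  rw [smul_comm]
  congr 1
  simp [EuclideanSpace.inner_single_left]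

/-- The curvature term `∑ᵢⱼ E_{ij} · R(e_i, e_j) · w` of the Weitzenböck formula. -/
def curvatureTerm (R : Eucl q → Eucl q → Eucl q →L[ℝ] Eucl q) (w : Alt q k) : Alt q k :=
  ∑ i, ∑ j, infAct (elemOp i j) (infAct (R (stdVec i) (stdVec j)) w)

/-- Both sides are `∑ⱼ e^j ∧ ι_{eᵢ} T(eⱼ)`, since `E_ij` acts on forms as `e^j ∧ ι_{eᵢ}`. -/
theorem alternatizeUncurryFin_interior_comp (T : Eucl q →L[ℝ] Alt q (k + 1)) (i : Fin q) :
    alternatizeUncurryFin ((interior (stdVec i)).comp T) =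
      ∑ j, infAct (elemOp i j) (T (stdVec j)) := by
  simp only [infAct_eq_alternatizeUncurryFin, ← alternatizeUncurryFinCLM_apply, ← map_sum]
  congr 1
  ext a : 1
  conv_lhs => rw [← sum_inner_stdVec a, map_sum]
  simp only [sum_apply, ContinuousLinearMap.comp_apply]
  refine Finset.sum_congr rfl fun j _ => ?_
  have h : elemOp i j a = inner ℝ (stdVec j) a • stdVec i := by
    simp [elemOp, EuclideanSpace.inner_single_left]
  have h' : (T (stdVec j)).curryLeft (inner ℝ (stdVec j) a • stdVec i) =
    inner ℝ (stdVec j) a • (T (stdVec j)).curryLeft (stdVec i) := map_smul _ _ _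
  rw [h, h', map_smul, map_smul]
  rfl

/-- The hypothesis is the shape of the Ricci identity; it replaces the antisymmetric part of `Q` by
the curvature action. -/
theorem weitzenboeck (Q : Eucl q →L[ℝ] Eucl q →L[ℝ] Alt q (k + 1)) (w : Alt q (k + 1))
    (R : Eucl q → Eucl q → Eucl q →L[ℝ] Eucl q)
    (hQ : ∀ a b, Q a b - Q b a = -infAct (R a b) w) :
    divergence ((alternatizeUncurryFinCLM ℝ (Eucl q) ℝ).comp Q) +
        alternatizeUncurryFin (divergence.comp Q) =
      ∑ i, Q (stdVec i) (stdVec i) + curvatureTerm R w := by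
  rw [weitzenboeck_algebra, curvatureTerm]
  congr 1
  refine Finset.sum_congr rfl fun i _ => ?_
  rw [alternatizeUncurryFin_interior_comp]
  refine Finset.sum_congr rfl fun j _ => ?_
  congr 1
  have := hQ (stdVec i) (stdVec j)
  rw [sub_apply, ContinuousLinearMap.flip_apply, ← neg_sub, this, neg_neg]

/-- Moving `P` past `R(e_i, e_j)` is allowed by `hP`, so only the failure `Z` to commute with `E_ij`
remains. Pair symmetry transfers the curvature coefficients from the second factor to the first,
where they reassemble `R(e_a, e_b)`, for which `Z` vanishes. -/
theorem curvatureTerm_comm (P : Alt q k →L[ℝ] Alt q k)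
    (R : Eucl q → Eucl q → Eucl q →L[ℝ] Eucl q)
    (hpair : ∀ i j a b : Fin q, inner ℝ (stdVec i) (R (stdVec a) (stdVec b) (stdVec j)) =
      inner ℝ (stdVec a) (R (stdVec i) (stdVec j) (stdVec b)))
    (hP : ∀ a b w, P (infAct (R a b) w) = infAct (R a b) (P w)) (w : Alt q k) :
    P (curvatureTerm R w) = curvatureTerm R (P w) := by
  let Z : (Eucl q →L[ℝ] Eucl q) →ₗ[ℝ] Alt q k →ₗ[ℝ] Alt q k :=
    LinearMap.mk₂ ℝ (fun X u => P (infAct X u) - infAct X (P u))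
      (by intros; simp; abel) (by intros; simp [smul_sub]) (by intros; simp; abel)
      (by intros; simp [smul_sub])
  have hZ : ∀ X u, Z X u = P (infAct X u) - infAct X (P u) := fun X u => rfl
  rw [← sub_eq_zero]
  calc P (curvatureTerm R w) - curvatureTerm R (P w)
      = ∑ i, ∑ j, Z (elemOp i j) (infAct (R (stdVec i) (stdVec j)) w) := by
        simp only [curvatureTerm, map_sum, ← Finset.sum_sub_distrib, hZ, hP]
    _ = ∑ i, ∑ j, ∑ a, ∑ b, inner ℝ (stdVec a) (R (stdVec i) (stdVec j) (stdVec b)) •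
          Z (elemOp i j) (infAct (elemOp a b) w) := by
        refine Finset.sum_congr rfl fun i _ => Finset.sum_congr rfl fun j _ => ?_
        conv_lhs => rw [← sum_elemOp (R (stdVec i) (stdVec j))]
        simp only [map_sum, map_smul, sum_apply, smul_apply]
    -- By `hpair` the coefficients of `R(e_i, e_j)` are those of `R(e_a, e_b)`; the sum over `i, j`
    -- is now carried out first.
    _ = ∑ a, ∑ b, Z (R (stdVec a) (stdVec b)) (infAct (elemOp a b) w) := by
        have h : ∀ a b : Fin q, Z (R (stdVec a) (stdVec b)) (infAct (elemOp a b) w) =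
            ∑ i, ∑ j, inner ℝ (stdVec a) (R (stdVec i) (stdVec j) (stdVec b)) •
              Z (elemOp i j) (infAct (elemOp a b) w) := fun a b => by
          conv_lhs => rw [← sum_elemOp (R (stdVec a) (stdVec b))]
          simp only [map_sum, map_smul, LinearMap.sum_apply, LinearMap.smul_apply, hpair]
        simp only [h]
        refine ((Finset.sum_congr rfl fun i _ => Finset.sum_comm).trans Finset.sum_comm).trans ?_
        exact Finset.sum_congr rfl fun a _ =>
          (Finset.sum_congr rfl fun i _ => Finset.sum_comm).trans Finset.sum_comm
    _ = 0 := by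
        refine Finset.sum_eq_zero fun a _ => Finset.sum_eq_zero fun b _ => ?_
        rw [hZ, hP, sub_self]

/-- The classical octahedron argument: the four cyclic identities are combined, and the two
antisymmetries identify the terms. -/
theorem pair_symm_of_bianchi {ι : Type*} (f : ι → ι → ι → ι → ℝ)
    (h12 : ∀ a b c d, f a b c d = -f b a c d) (h34 : ∀ a b c d, f a b c d = -f a b d c)
    (hcyc : ∀ a b c d, f a b c d + f b c a d + f c a b d = 0) (a b c d : ι) :
    f a b c d = f c d a b := by
  linarith [hcyc a b c d, hcyc b c d a, hcyc c d a b, hcyc d a b c, h12 a b c d, h12 b c d a,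
    h12 c d a b, h12 d a b c, h34 a b c d, h34 b c d a, h34 c d a b, h34 d a b c, h12 c a b d,
    h12 b d c a, h12 a c d b, h12 d b a c, h34 c a b d, h34 b d c a, h34 a c d b, h34 d b a c,
    h34 a c b d, h34 d b c a]

end InfinitesimalAction

/-! ### The Hodge star on `ℝ^q` -/

section HodgeStar

variable {q k l : ℕ}

theorem stdVec_apply (i j : Fin q) : (stdVec i : Eucl q) j = if j = i then 1 else 0 := by
  simp [stdVec]

theorem altStar_apply (h : k + l = q) (w : Alt q k) (v : Fin l → Eucl q) :
    altStar h w v = ((k.factorial : ℝ) * (l.factorial : ℝ))⁻¹ * ∑ σ : Equiv.Perm (Fin q),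
      (((Equiv.Perm.sign σ : ℤ) : ℝ) * w (fun i => stdVec (σ (Fin.cast h (Fin.castAdd l i))))) *
        elemForm (fun j => σ (Fin.cast h (Fin.natAdd k j))) v := by
  simp [altStar, ContinuousAlternatingMap.sum_apply]

/-- The permutation of `Fin (k + l)` which preserves the two blocks. -/
def blockPerm (p : Equiv.Perm (Fin k) × Equiv.Perm (Fin l)) : Equiv.Perm (Fin (k + l)) :=
  finSumFinEquiv.permCongr (Equiv.Perm.sumCongr p.1 p.2)

theorem blockPerm_castAdd (p : Equiv.Perm (Fin k) × Equiv.Perm (Fin l)) (i : Fin k) :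
    blockPerm p (Fin.castAdd l i) = Fin.castAdd l (p.1 i) := by
  simp [blockPerm, Equiv.permCongr_apply]

theorem blockPerm_natAdd (p : Equiv.Perm (Fin k) × Equiv.Perm (Fin l)) (i : Fin l) :
    blockPerm p (Fin.natAdd k i) = Fin.natAdd k (p.2 i) := by
  simp [blockPerm, Equiv.permCongr_apply]

theorem sign_blockPerm (p : Equiv.Perm (Fin k) × Equiv.Perm (Fin l)) :
    Equiv.Perm.sign (blockPerm p) = Equiv.Perm.sign p.1 * Equiv.Perm.sign p.2 := by
  rw [blockPerm, Equiv.Perm.sign_permCongr, Equiv.Perm.sign_sumCongr]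

theorem blockPerm_injective :
    Function.Injective (blockPerm : Equiv.Perm (Fin k) × Equiv.Perm (Fin l) → _) := by
  intro p p' h
  refine Prod.ext (Equiv.ext fun i => ?_) (Equiv.ext fun i => ?_)
  · have := DFunLike.congr_fun h (Fin.castAdd l i)
    simpa only [blockPerm_castAdd, Fin.castAdd_inj] using this
  · have := DFunLike.congr_fun h (Fin.natAdd k i)
    simpa only [blockPerm_natAdd, Fin.natAdd_inj] using this

theorem exists_blockPerm_eq (σ : Equiv.Perm (Fin (k + l)))
    (h : ∀ b, ∃ a, σ (Fin.natAdd k b) = Fin.natAdd k a) : ∃ p, blockPerm p = σ := by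
  have hr : Set.MapsTo (finSumFinEquiv.symm.permCongr σ) (Set.range Sum.inr)
      (Set.range (Sum.inr : Fin l → Fin k ⊕ Fin l)) := by
    rintro _ ⟨b, rfl⟩
    obtain ⟨a, ha⟩ := h b
    exact ⟨a, by simp [Equiv.permCongr_apply, ha]⟩
  obtain ⟨p, hp⟩ := Equiv.Perm.mem_sumCongrHom_range_of_perm_mapsTo_inl
    ((Equiv.Perm.perm_mapsTo_inl_iff_mapsTo_inr _).2 hr)
  refine ⟨p, ?_⟩
  have : Equiv.Perm.sumCongr p.1 p.2 = finSumFinEquiv.symm.permCongr σ := hp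
  rw [blockPerm, this]
  ext i
  simp [Equiv.permCongr_apply]

/-- On basis vectors only permutations `τ * blockPerm p` contribute: otherwise the determinant has a
zero column. There are `k! l!` of them with equal contributions, because the signs of the two block
permutations appear twice. This cancels the normalizing factor. -/
theorem altStar_stdVec (h : k + l = q) (w : Alt q k) (τ : Equiv.Perm (Fin q)) :
    altStar h w (fun j => stdVec (τ (Fin.cast h (Fin.natAdd k j)))) =
      ((Equiv.Perm.sign τ : ℤ) : ℝ) *
        w (fun i => stdVec (τ (Fin.cast h (Fin.castAdd l i)))) := by
  subst h
  rw [altStar_apply, inv_mul_eq_iff_eq_mul₀ (by positivity), ← Equiv.sum_comp (Equiv.mulLeft τ)]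
  simp only [Fin.cast_refl, id_eq, Equiv.coe_mulLeft]
  symm
  calc ((k.factorial : ℝ) * (l.factorial : ℝ)) * (((Equiv.Perm.sign τ : ℤ) : ℝ) *
          w (fun i => stdVec (τ (Fin.castAdd l i))))
      = ∑ _p : Equiv.Perm (Fin k) × Equiv.Perm (Fin l), ((Equiv.Perm.sign τ : ℤ) : ℝ) *
          w (fun i => stdVec (τ (Fin.castAdd l i))) := by
        simp [Fintype.card_perm]
    _ = _ := ?_
  refine Finset.sum_of_injOn blockPerm blockPerm_injective.injOn (by simp) ?_ ?_
  -- If `σ` does not preserve the last block, some covector of the elementary form vanishes on all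
  -- the vectors.
  · intro σ _ hσ
    have : ∃ b, ∀ a, σ (Fin.natAdd k b) ≠ Fin.natAdd k a := by
      by_contra! hcon
      obtain ⟨p, hp⟩ := exists_blockPerm_eq σ hcon
      exact hσ ⟨p, by simp, hp⟩
    obtain ⟨b, hb⟩ := this
    rw [elemForm_apply, Matrix.det_eq_zero_of_column_eq_zero b, mul_zero]
    intro a
    simp [Matrix.of_apply, hb a]
  · intro p _
    have hdet : elemForm (fun j => (τ * blockPerm p) (Fin.natAdd k j))
        (fun j => stdVec (τ (Fin.natAdd k j))) = ((Equiv.Perm.sign p.2 : ℤ) : ℝ) := by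
      rw [elemForm_apply]
      have : (Matrix.of fun a b => (stdVec (τ (Fin.natAdd k a)) : Eucl (k + l))
          ((τ * blockPerm p) (Fin.natAdd k b))) =
          (1 : Matrix (Fin l) (Fin l) ℝ).submatrix id p.2 := by
        ext a b
        rw [Matrix.of_apply, stdVec_apply, Equiv.Perm.mul_apply, blockPerm_natAdd,
          Matrix.submatrix_apply, Matrix.one_apply]
        simp [eq_comm]
      rw [this, Matrix.det_permute', Matrix.det_one, mul_one]
    have hw : w (fun i => stdVec ((τ * blockPerm p) (Fin.castAdd l i))) =
        ((Equiv.Perm.sign p.1 : ℤ) : ℝ) * w (fun i => stdVec (τ (Fin.castAdd l i))) := by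
      have := w.toAlternatingMap.map_perm (fun i => stdVec (τ (Fin.castAdd l i))) p.1
      rw [Units.smul_def, zsmul_eq_mul] at this
      simp only [Equiv.Perm.mul_apply, blockPerm_castAdd]
      exact this
    rw [hdet, hw, Equiv.Perm.sign_mul, sign_blockPerm]
    have h1 : ((Equiv.Perm.sign p.1 : ℤ) : ℝ) * ((Equiv.Perm.sign p.1 : ℤ) : ℝ) = 1 := by
      rw [← Int.cast_mul, ← Units.val_mul, Int.units_mul_self]; simp
    have h2 : ((Equiv.Perm.sign p.2 : ℤ) : ℝ) * ((Equiv.Perm.sign p.2 : ℤ) : ℝ) = 1 := by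
      rw [← Int.cast_mul, ← Units.val_mul, Int.units_mul_self]; simp
    push_cast
    linear_combination (-((Equiv.Perm.sign τ : ℤ) : ℝ) *
        w (fun i => stdVec (τ (Fin.castAdd l i)))) * h1 - (((Equiv.Perm.sign τ : ℤ) : ℝ) *
        w (fun i => stdVec (τ (Fin.castAdd l i)))) * ((Equiv.Perm.sign p.1 : ℤ) : ℝ) ^ 2 * h2

/-- Elementary forms represent evaluation on basis vectors: the `l!` terms of the determinant each
contribute the same value, against the factor `1 / l!`. -/
theorem altInner_elemForm (J : Fin l → Fin q) (w : Alt q l) :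
    altInner q l (elemForm J) w = w (fun j => stdVec (J j)) := by
  rw [altInner_apply, inv_mul_eq_iff_eq_mul₀ (by positivity)]
  have h : ∀ I : Fin l → Fin q, elemForm J (fun j => stdVec (I j)) =
      ∑ π : Equiv.Perm (Fin l), ((Equiv.Perm.sign π : ℤ) : ℝ) *
        if I ∘ π = J then 1 else 0 := fun I => by
    rw [elemForm_apply, Matrix.det_apply']
    refine Finset.sum_congr rfl fun π _ => congrArg _ ?_
    simp only [Matrix.of_apply, stdVec_apply]
    rw [Finset.prod_ite_zero]
    simp [funext_iff, eq_comm]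
  simp only [h, Finset.sum_mul]
  rw [Finset.sum_comm]
  have h2 : ∀ π : Equiv.Perm (Fin l), (∑ I : Fin l → Fin q, ((Equiv.Perm.sign π : ℤ) : ℝ) *
      (if I ∘ π = J then 1 else 0) * w (fun j => stdVec (I j))) =
        w (fun j => stdVec (J j)) := fun π => by
    rw [Finset.sum_eq_single (J ∘ π.symm)]
    · have := w.toAlternatingMap.map_perm (fun j => stdVec (J j)) π.symm
      rw [Units.smul_def, zsmul_eq_mul, Equiv.Perm.sign_symm] at this
      have hw : w (fun j => stdVec ((J ∘ π.symm) j)) =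
        ((Equiv.Perm.sign π : ℤ) : ℝ) * w (fun j => stdVec (J j)) := this
      rw [hw, if_pos (by ext; simp), mul_one, ← mul_assoc, ← Int.cast_mul, ← Units.val_mul,
        Int.units_mul_self]
      simp
    · intro I _ hI
      rw [if_neg, mul_zero, zero_mul]
      rintro rfl
      exact hI (by ext; simp)
    · simp
  simp only [h2]
  simp [Fintype.card_perm]

theorem orthGroup_inner (a : OrthGroup q) (u v : Eucl q) :
    inner ℝ ((a : Eucl q →L[ℝ] Eucl q) u) ((a : Eucl q →L[ℝ] Eucl q) v) = inner ℝ u v := by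
  rw [← ContinuousLinearMap.adjoint_inner_right, ← ContinuousLinearMap.star_eq_adjoint,
    ← mul_apply_eq_comp, Unitary.coe_star_mul_self, one_apply_eq_self]

theorem sum_inner_orthGroup (a : OrthGroup q) (j j' : Fin q) :
    ∑ i, ((a : Eucl q →L[ℝ] Eucl q) (stdVec i)) j * ((a : Eucl q →L[ℝ] Eucl q) (stdVec i)) j' =
      if j = j' then 1 else 0 := by
  have h : ∀ (i j : Fin q), ((a : Eucl q →L[ℝ] Eucl q) (stdVec i)) j =
      inner ℝ (stdVec i) (((a⁻¹ : OrthGroup q) : Eucl q →L[ℝ] Eucl q) (stdVec j)) := fun i j => by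
    rw [← orthGroup_inner a, ← mul_apply_eq_comp, ← Submonoid.coe_mul, mul_inv_cancel]
    simp [EuclideanSpace.inner_single_right]
  simp only [h]
  have h2 := (EuclideanSpace.basisFun (Fin q) ℝ).sum_inner_mul_inner
    (((a⁻¹ : OrthGroup q) : Eucl q →L[ℝ] Eucl q) (stdVec j))
    (((a⁻¹ : OrthGroup q) : Eucl q →L[ℝ] Eucl q) (stdVec j'))
  rw [orthGroup_inner] at h2
  simp only [EuclideanSpace.basisFun_apply] at h2
  simp only [real_inner_comm] at h2 ⊢
  rw [h2]
  simp [EuclideanSpace.inner_single_left]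

theorem alt_apply_eq_sum (w : Alt q k) (v : Fin k → Eucl q) :
    w v = ∑ J : Fin k → Fin q, (∏ i, v i (J i)) * w (fun i => stdVec (J i)) := by
  have hv : v = fun i => ∑ j, v i j • stdVec j := by
    funext i
    conv_lhs => rw [← sum_inner_stdVec (v i)]
    simp [EuclideanSpace.inner_single_left]
  conv_lhs => rw [hv, w.map_sum]
  refine Finset.sum_congr rfl fun J _ => ?_
  have := w.toMultilinearMap.map_smul_univ (fun i => v i (J i)) (fun i => stdVec (J i))
  exact this

/-- Expanding each argument in the basis reduces the claim, slot by slot, to the orthonormality of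
the rows of `a`. -/
theorem altInner_comp_orthGroup (a : OrthGroup q) (w w' : Alt q k) :
    altInner q k (w.compContinuousLinearMap (a : Eucl q →L[ℝ] Eucl q))
      (w'.compContinuousLinearMap (a : Eucl q →L[ℝ] Eucl q)) = altInner q k w w' := by
  rw [altInner_apply, altInner_apply]
  congr 1
  have h : ∀ (w : Alt q k) (I : Fin k → Fin q),
      w.compContinuousLinearMap (a : Eucl q →L[ℝ] Eucl q) (fun j => stdVec (I j)) =
      ∑ J : Fin k → Fin q, (∏ i, ((a : Eucl q →L[ℝ] Eucl q) (stdVec (I i))) (J i)) *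
        w (fun i => stdVec (J i)) := fun w I => alt_apply_eq_sum w _
  simp only [h, Finset.sum_mul_sum]
  rw [Finset.sum_comm]
  refine Finset.sum_congr rfl fun J _ => ?_
  rw [Finset.sum_comm]
  have h2 : ∀ J' : Fin k → Fin q, (∑ I : Fin k → Fin q,
      (∏ i, ((a : Eucl q →L[ℝ] Eucl q) (stdVec (I i))) (J i)) * w (fun i => stdVec (J i)) *
      ((∏ i, ((a : Eucl q →L[ℝ] Eucl q) (stdVec (I i))) (J' i)) * w' (fun i => stdVec (J' i)))) =
      (if J = J' then 1 else 0) * (w (fun i => stdVec (J i)) * w' (fun i => stdVec (J' i))) := by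
    intro J'
    have h3 := Finset.prod_univ_sum (fun _ : Fin k => (Finset.univ : Finset (Fin q)))
      (fun i x => ((a : Eucl q →L[ℝ] Eucl q) (stdVec x)) (J i) *
        ((a : Eucl q →L[ℝ] Eucl q) (stdVec x)) (J' i))
    simp only [sum_inner_orthGroup, Fintype.piFinset_univ, Finset.prod_mul_distrib] at h3
    have h4 : (∏ i, if J i = J' i then (1 : ℝ) else 0) = if J = J' then 1 else 0 := by
      rw [Finset.prod_ite_zero]; simp [funext_iff]
    rw [← h4, h3, Finset.sum_mul]
    exact Finset.sum_congr rfl fun I _ => by ring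
  simp only [h2]
  simp

/-- The top form `∑ sgn(σ) w(v_{σ 1}, …, v_{σ k}) w'(v_{σ (k+1)}, …, v_{σ (k+l)})`. -/
def topPairing (w : Alt q k) (w' : Alt q l) : Eucl q [⋀^Fin (k + l)]→ₗ[ℝ] ℝ :=
  MultilinearMap.alternatization ((LinearMap.mul' ℝ ℝ).compMultilinearMap
    ((w.toMultilinearMap.domCoprod w'.toMultilinearMap).domDomCongr finSumFinEquiv))

theorem topPairing_apply (w : Alt q k) (w' : Alt q l) (v : Fin (k + l) → Eucl q) :
    topPairing w w' v = ∑ σ : Equiv.Perm (Fin (k + l)), ((Equiv.Perm.sign σ : ℤ) : ℝ) *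
      (w (fun i => v (σ (Fin.castAdd l i))) * w' (fun i => v (σ (Fin.natAdd k i)))) := by
  simp [topPairing, MultilinearMap.alternatization_apply, Units.smul_def]

theorem alternatingMap_comp_eq_det_mul (f : Eucl q [⋀^Fin q]→ₗ[ℝ] ℝ)
    (a : Eucl q →L[ℝ] Eucl q) (v : Fin q → Eucl q) :
    f (fun i => a (v i)) = LinearMap.det (a : Eucl q →ₗ[ℝ] Eucl q) * f v := by
  rw [f.eq_smul_basis_det (EuclideanSpace.basisFun (Fin q) ℝ).toBasis]
  have := (EuclideanSpace.basisFun (Fin q) ℝ).toBasis.det_comp (a : Eucl q →ₗ[ℝ] Eucl q) v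
  simp only [AlternatingMap.smul_apply, smul_eq_mul]
  have h2 : (fun i => a (v i)) = (a : Eucl q →ₗ[ℝ] Eucl q) ∘ v := rfl
  rw [h2, this]
  ring

/-- This characterizes the star by a top-degree form, on which an operator acts only through its
determinant. -/
theorem altInner_altStar (w : Alt (k + l) k) (w' : Alt (k + l) l) :
    altInner (k + l) l (altStar rfl w) w' =
      ((k.factorial : ℝ) * (l.factorial : ℝ))⁻¹ * topPairing w w' stdVec := by
  have h : altStar rfl w = ((k.factorial : ℝ) * (l.factorial : ℝ))⁻¹ •
    ∑ σ : Equiv.Perm (Fin (k + l)),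
      (((Equiv.Perm.sign σ : ℤ) : ℝ) * w (fun i => stdVec (σ (Fin.castAdd l i)))) •
        elemForm (fun j => σ (Fin.natAdd k j)) := rfl
  rw [h]
  simp only [map_smul, map_sum, LinearMap.smul_apply, LinearMap.sum_apply, altInner_elemForm,
    topPairing_apply, smul_eq_mul, mul_assoc]

/-- An orthogonal operator preserves the scalar product, and with determinant one also the top form
that defines the star. -/
theorem altStar_comp (h : k + l = q) (a : OrthGroup q)
    (ha : LinearMap.det ((a : Eucl q →L[ℝ] Eucl q) : Eucl q →ₗ[ℝ] Eucl q) = 1) (w : Alt q k) :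
    altStar h (w.compContinuousLinearMap (a : Eucl q →L[ℝ] Eucl q)) =
      (altStar h w).compContinuousLinearMap (a : Eucl q →L[ℝ] Eucl q) := by
  subst h
  have key : ∀ w' : Alt (k + l) l, altInner (k + l) l
      (altStar rfl (w.compContinuousLinearMap (a : Eucl (k + l) →L[ℝ] Eucl (k + l))))
      (w'.compContinuousLinearMap (a : Eucl (k + l) →L[ℝ] Eucl (k + l))) =
      altInner (k + l) l ((altStar rfl w).compContinuousLinearMap
        (a : Eucl (k + l) →L[ℝ] Eucl (k + l)))
      (w'.compContinuousLinearMap (a : Eucl (k + l) →L[ℝ] Eucl (k + l))) := fun w' => by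
    rw [altInner_comp_orthGroup, altInner_altStar, altInner_altStar]
    congr 1
    have := alternatingMap_comp_eq_det_mul (topPairing w w') a stdVec
    rw [ha, one_mul] at this
    rw [← this, topPairing_apply, topPairing_apply]
    rfl
  rw [← sub_eq_zero]
  refine altInner_self_eq_zero ?_
  set d := altStar rfl (w.compContinuousLinearMap (a : Eucl (k + l) →L[ℝ] Eucl (k + l))) -
    (altStar rfl w).compContinuousLinearMap (a : Eucl (k + l) →L[ℝ] Eucl (k + l)) with hd
  -- Every form is a pull-back by `a`, so `key` may be tested on the difference `d` itself, and
  -- definiteness gives `d = 0`.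
  have hdd : d = (d.compContinuousLinearMap ((a⁻¹ : OrthGroup (k + l)) :
      Eucl (k + l) →L[ℝ] Eucl (k + l))).compContinuousLinearMap
      (a : Eucl (k + l) →L[ℝ] Eucl (k + l)) := by
    have haa : ∀ u, ((a⁻¹ : OrthGroup (k + l)) : Eucl (k + l) →L[ℝ] Eucl (k + l))
        ((a : Eucl (k + l) →L[ℝ] Eucl (k + l)) u) = u := fun u => by
      rw [← mul_apply_eq_comp, ← Submonoid.coe_mul, inv_mul_cancel]; simp
    ext v
    simp only [compContinuousLinearMap_apply, Function.comp_def, haa]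
  have := key (d.compContinuousLinearMap ((a⁻¹ : OrthGroup (k + l)) :
      Eucl (k + l) →L[ℝ] Eucl (k + l)))
  rw [← hdd] at this
  have hsub := LinearMap.map_sub₂ (altInner (k + l) l)
    (altStar rfl (w.compContinuousLinearMap (a : Eucl (k + l) →L[ℝ] Eucl (k + l))))
    ((altStar rfl w).compContinuousLinearMap (a : Eucl (k + l) →L[ℝ] Eucl (k + l))) d
  rw [← hd, this, sub_self] at hsub
  exact hsub

theorem finRotate_succ_pow_apply (N m : ℕ) (x : Fin (N + 1)) :
    (((finRotate (N + 1)) ^ m) x : ℕ) = (x + m) % (N + 1) := by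
  induction m with
  | zero => simp [Nat.mod_eq_of_lt x.2]
  | succ m ih =>
    rw [pow_succ', Equiv.Perm.mul_apply, finRotate_apply, Fin.val_add, ih, Fin.val_one',
      ← Nat.add_mod, add_assoc]

/-- The permutation of `Fin N`, `N = m + k`, which adds `m` modulo `N`, and its sign. -/
theorem exists_blockSwap (N m k : ℕ) (h : m + k = N) : ∃ ρ : Equiv.Perm (Fin N),
    Equiv.Perm.sign ρ = (-1) ^ (k * m) ∧ (∀ x : Fin N, (x : ℕ) < k → (ρ x : ℕ) = m + x) ∧
    ∀ x : Fin N, k ≤ (x : ℕ) → (ρ x : ℕ) = x - k := by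
  cases N with
  | zero =>
    obtain rfl : m = 0 := by omega
    exact ⟨1, by simp, fun x => x.elim0, fun x => x.elim0⟩
  | succ N =>
    refine ⟨finRotate (N + 1) ^ m, ?_, fun x hx => ?_, fun x hx => ?_⟩
    · rw [map_pow, sign_finRotate, Nat.add_sub_cancel, ← pow_mul]
      rcases Nat.eq_zero_or_pos m with rfl | hm
      · simp
      obtain ⟨m, rfl⟩ : ∃ m', m = m' + 1 := ⟨m - 1, by omega⟩
      obtain rfl : N = m + k := by omega
      -- The rotation has sign `(-1) ^ (m + k)`, and the surplus exponent `m * (m + 1)` is even.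
      have : (m + k) * (m + 1) = k * (m + 1) + m * (m + 1) := by ring
      rw [this, pow_add, (Nat.even_mul_succ_self m).neg_one_pow, mul_one]
    · rw [finRotate_succ_pow_apply, Nat.mod_eq_of_lt (by omega), add_comm]
    · rw [finRotate_succ_pow_apply]
      have hx2 := x.2
      have : (x : ℕ) + m = (x - k) + (N + 1) := by omega
      rw [this, Nat.add_mod_right, Nat.mod_eq_of_lt (by omega)]

theorem exists_perm_extending {m k q : ℕ} (h : m + k = q) {J : Fin k → Fin q}
    (hJ : Function.Injective J) :
    ∃ τ : Equiv.Perm (Fin q), ∀ j, τ (Fin.cast h (Fin.natAdd m j)) = J j := by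
  obtain ⟨τ, hτ⟩ := Equiv.Perm.exists_extending_pair
    (fun j : Fin k => Fin.cast h (Fin.natAdd m j)) J (by
      intro a b hab
      simpa using hab) hJ
  exact ⟨τ, fun j => hτ j⟩

/-- This is `⋆(a ∧ ⋆w) = ± ι_a w` for a covector `a` and the vector dual to it, summed over a basis.
Both sides are evaluated on `e_J`, completed to a permutation `τ` of the basis with `J` as last
block, and the sign comes from a comparison of orderings. -/
theorem altStar_alternatizeUncurryFin_altStar {m : ℕ} (h1 : k + 1 + m = q) (h2 : m + 1 + k = q)
    (Φ : Eucl q →L[ℝ] Alt q (k + 1)) :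
    altStar h2 (alternatizeUncurryFin ((altStar h1).toContinuousLinearMap.comp Φ)) =
      (-1 : ℝ) ^ (k * m) • divergence Φ := by
  refine alt_ext fun J => ?_
  by_cases hJ : Function.Injective J
  swap
  · have hJ' : ¬ Function.Injective (fun j => (stdVec (J j) : Eucl q)) := fun h =>
      hJ fun a b hab => h (congrArg stdVec hab)
    have (w : Alt q k) : w (fun j => stdVec (J j)) = 0 :=
      w.toAlternatingMap.map_eq_zero_of_not_injective _ hJ'
    rw [this, this]
  obtain ⟨τ, hτ⟩ := exists_perm_extending h2 hJ
  obtain ⟨N, rfl⟩ : ∃ N, q = N + 1 := ⟨q - 1, by omega⟩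
  obtain ⟨ρ, hρs, hρ1, hρ2⟩ := exists_blockSwap N m k (by omega)
  simp only [← hτ]
  rw [altStar_stdVec, alternatizeUncurryFin_apply]
  let c : Fin (m + 1) → Fin (N + 1) := fun i => Fin.cast h2 (Fin.castAdd k i)
  have key : ∀ i : Fin (m + 1),
      altStar h1 (Φ (stdVec (τ (c i)))) (fun j => stdVec (τ (c (i.succAbove j)))) =
      ((Equiv.Perm.sign τ : ℤ) : ℝ) * (-1) ^ (i : ℕ) * (-1) ^ (k * m) *
        Φ (stdVec (τ (c i))) (Matrix.vecCons (stdVec (τ (c i)))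
          fun j => stdVec (τ (Fin.cast h2 (Fin.natAdd (m + 1) j)))) := by
    intro i
    -- The reordering: the chosen front index `c i` comes first, then the block `J`, then the other
    -- `m` front indices. Pulling `c i` to the front costs `(-1) ^ i`, exchanging the two blocks
    -- costs `(-1) ^ (k * m)`.
    let τ' : Equiv.Perm (Fin (N + 1)) :=
      τ * (c i).cycleRange.symm * Equiv.Perm.decomposeFin.symm (0, ρ)
    have hs : ((Equiv.Perm.sign τ' : ℤ) : ℝ) =
        ((Equiv.Perm.sign τ : ℤ) : ℝ) * (-1) ^ (i : ℕ) * (-1) ^ (k * m) := by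
      simp [τ', hρs, Equiv.Perm.sign_symm, Fin.sign_cycleRange, c]
    have h0 : τ' 0 = τ (c i) := by
      simp [τ', Fin.cycleRange_symm_zero]
    have hsucc : ∀ x, τ' (Fin.succ x) = τ ((c i).succAbove (ρ x)) := fun x => by
      simp [τ', Fin.cycleRange_symm_succ]
    have hci : ((c i : Fin (N + 1)) : ℕ) = i := rfl
    have hA : (fun j => stdVec (τ (c (i.succAbove j)))) =
        fun j : Fin m => (stdVec (τ' (Fin.cast h1 (Fin.natAdd (k + 1) j))) : Eucl (N + 1)) := by
      funext j
      have : Fin.cast h1 (Fin.natAdd (k + 1) j) = Fin.succ ⟨k + j, by omega⟩ := by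
        ext; simp; omega
      rw [this, hsucc]
      congr 2
      ext
      simp only [Fin.succAbove, Fin.lt_def, Fin.val_castSucc, hci]
      rw [hρ2 _ (by simp)]
      simp only [Nat.add_sub_cancel_left, c]
      split_ifs <;> simp [hρ2]
    have hB : (fun j : Fin (k + 1) =>
        (stdVec (τ' (Fin.cast h1 (Fin.castAdd m j))) : Eucl (N + 1))) =
        Matrix.vecCons (stdVec (τ (c i)))
          fun j => stdVec (τ (Fin.cast h2 (Fin.natAdd (m + 1) j))) := by
      funext j
      refine Fin.cases ?_ (fun j => ?_) j
      · have : Fin.cast h1 (Fin.castAdd m 0) = 0 := by ext; simp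
        rw [this, h0]; rfl
      · have : Fin.cast h1 (Fin.castAdd m j.succ) = Fin.succ ⟨j, by omega⟩ := by
          ext; simp
        rw [this, hsucc, Matrix.cons_val_succ]
        congr 2
        ext
        have hi := i.2
        simp only [Fin.succAbove, Fin.lt_def, Fin.val_castSucc, hci]
        rw [hρ1 _ (by simp), if_neg (by simp; omega), Fin.val_succ, hρ1 _ (by simp)]
        simp; omega
    rw [hA, altStar_stdVec h1 _ τ', hB, hs]
  have hL : ∀ i : Fin (m + 1), (-1 : ℤ) ^ (i : ℕ) •
      ((altStar h1).toContinuousLinearMap.comp Φ) (stdVec (τ (c i)))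
        (i.removeNth fun j => stdVec (τ (c j))) = ((Equiv.Perm.sign τ : ℤ) : ℝ) *
        (-1) ^ (k * m) * Φ (stdVec (τ (c i))) (Matrix.vecCons (stdVec (τ (c i)))
          fun j => stdVec (τ (Fin.cast h2 (Fin.natAdd (m + 1) j)))) := fun i => by
    have := key i
    have hr : (i.removeNth fun j => (stdVec (τ (c j)) : Eucl (N + 1))) =
      fun j => stdVec (τ (c (i.succAbove j))) := rfl
    rw [hr, ContinuousLinearMap.comp_apply, LinearMap.coe_toContinuousLinearMap', this,
      zsmul_eq_mul]
    have h1 : ((-1 : ℝ) ^ (i : ℕ)) * (-1 : ℝ) ^ (i : ℕ) = 1 := by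
      rw [← mul_pow]; simp
    push_cast
    linear_combination (((Equiv.Perm.sign τ : ℤ) : ℝ) *
        (-1) ^ (k * m) * Φ (stdVec (τ (c i))) (Matrix.vecCons (stdVec (τ (c i)))
          fun j => stdVec (τ (Fin.cast h2 (Fin.natAdd (m + 1) j))))) * h1
  rw [Finset.sum_congr rfl fun i _ => hL i, ← Finset.mul_sum]
  have hR : divergence Φ (fun j => stdVec (τ (Fin.cast h2 (Fin.natAdd (m + 1) j)))) =
      ∑ i : Fin (m + 1), Φ (stdVec (τ (c i))) (Matrix.vecCons (stdVec (τ (c i)))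
          fun j => stdVec (τ (Fin.cast h2 (Fin.natAdd (m + 1) j)))) := by
    rw [divergence_apply, ContinuousAlternatingMap.sum_apply, ← Equiv.sum_comp τ,
      ← Equiv.sum_comp (finCongr h2), Fin.sum_univ_add]
    -- Indices from the block `J` contribute nothing to the divergence, since they repeat an
    -- argument.
    refine (congrArg₂ (· + ·) rfl (Finset.sum_eq_zero fun j _ => ?_)).trans (add_zero _)
    · refine (Φ _).toAlternatingMap.map_eq_zero_of_eq _ (i := 0) (j := j.succ) ?_
        (Fin.succ_ne_zero j).symm
      simp
  rw [ContinuousAlternatingMap.smul_apply, hR, smul_eq_mul]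
  have h1 : ((Equiv.Perm.sign τ : ℤ) : ℝ) * ((Equiv.Perm.sign τ : ℤ) : ℝ) = 1 := by
    rw [← Int.cast_mul, ← Units.val_mul, Int.units_mul_self]; simp
  linear_combination ((-1 : ℝ) ^ (k * m) * ∑ i : Fin (m + 1), Φ (stdVec (τ (c i)))
    (Matrix.vecCons (stdVec (τ (c i)))
          fun j => stdVec (τ (Fin.cast h2 (Fin.natAdd (m + 1) j))))) * h1

end HodgeStar

/-! ### Equivariant operators -/

section Equivariance

variable {q k l : ℕ} {G : Subgroup (OrthGroup q)}

/-- The determinant is continuous with square one and equals one at the identity; a value `-1` on a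
connected set would force the value `0`. -/
theorem det_eq_one_of_isConnected (hG : IsConnected (G : Set (OrthGroup q))) {a : OrthGroup q}
    (ha : a ∈ G) : LinearMap.det ((a : Eucl q →L[ℝ] Eucl q) : Eucl q →ₗ[ℝ] Eucl q) = 1 := by
  let f : OrthGroup q → ℝ := fun a => ContinuousLinearMap.det (a : Eucl q →L[ℝ] Eucl q)
  have hf : Continuous f := ContinuousLinearMap.continuous_det.comp continuous_subtype_val
  have hsq : ∀ a : OrthGroup q, f a * f a = 1 := fun a => by
    let e : Eucl q →ₗᵢ[ℝ] Eucl q := LinearMap.isometryOfInner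
      ((a : Eucl q →L[ℝ] Eucl q) : Eucl q →ₗ[ℝ] Eucl q) (orthGroup_inner a)
    have h := LinearMap.normDet_eq_abs_det e.toLinearMap
    rw [e.normDet_eq_one] at h
    have h2 : |f a| = 1 := h.symm
    rw [← abs_mul_abs_self, h2, mul_one]
  have hconn : IsPreconnected (f '' (G : Set (OrthGroup q))) :=
    hG.isPreconnected.image f hf.continuousOn
  have h1 : (1 : ℝ) ∈ f '' (G : Set (OrthGroup q)) := ⟨1, G.one_mem, by
    simp [f, ContinuousLinearMap.det]⟩
  have hfa : f a ∈ f '' (G : Set (OrthGroup q)) := ⟨a, ha, rfl⟩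
  rcases mul_self_eq_one_iff.1 (hsq a) with h | h
  · exact h
  · exfalso
    have h0 : (0 : ℝ) ∈ f '' (G : Set (OrthGroup q)) :=
      hconn.ordConnected.out hfa h1 (by rw [h]; constructor <;> norm_num)
    obtain ⟨b, -, hb⟩ := h0
    have := hsq b
    rw [hb] at this
    norm_num at this

/-- The operator `T` on alternating forms is equivariant. -/
def IsEquivariant (G : Subgroup (OrthGroup q)) (T : Alt q k →ₗ[ℝ] Alt q l) : Prop :=
  ∀ a ∈ G, ∀ w, T (w.compContinuousLinearMap (a : Eucl q →L[ℝ] Eucl q)) =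
    (T w).compContinuousLinearMap (a : Eucl q →L[ℝ] Eucl q)

theorem isEquivariant_altStar (hG : IsConnected (G : Set (OrthGroup q))) (h : k + l = q) :
    IsEquivariant G (altStar h) := fun _ ha w =>
  altStar_comp h _ (det_eq_one_of_isConnected hG ha) w

theorem orthGroup_inv_apply (a : OrthGroup q) (u : Eucl q) :
    ((a⁻¹ : OrthGroup q) : Eucl q →L[ℝ] Eucl q) ((a : Eucl q →L[ℝ] Eucl q) u) = u := by
  rw [← mul_apply_eq_comp, ← Submonoid.coe_mul, inv_mul_cancel]
  simp

theorem altProj_mem (W : Submodule ℝ (Alt q k)) (w : Alt q k) : altProj W w ∈ W := by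
  simp [altProj]

theorem sub_altProj_mem (W : Submodule ℝ (Alt q k)) (w : Alt q k) :
    w - altProj W w ∈ (altInner q k).orthogonal W :=
  Submodule.sub_projection_mem (isCompl_orthogonal W) w

theorem altProj_eq_of_mem (W : Submodule ℝ (Alt q k)) {u w : Alt q k} (hu : u ∈ W)
    (hw : w - u ∈ (altInner q k).orthogonal W) : altProj W w = u := by
  have h1 : altProj W w - u ∈ W := W.sub_mem (altProj_mem W w) hu
  have h2 : altProj W w - u ∈ (altInner q k).orthogonal W := by
    have := Submodule.sub_mem _ hw (sub_altProj_mem W w)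
    convert this using 1
    abel
  exact sub_eq_zero.1 ((Submodule.disjoint_def.1 (isCompl_orthogonal W).disjoint) _ h1 h2)

/-- The action is orthogonal, so it preserves the orthogonal complement of `W` together with `W`. -/
theorem isEquivariant_altProj {W : Submodule ℝ (Alt q k)} (hW : IsInvariant G W) :
    IsEquivariant G (altProj W) := by
  intro a ha w
  have hW' : ∀ b ∈ G, ∀ u ∈ W, u.compContinuousLinearMap (b : Eucl q →L[ℝ] Eucl q) ∈ W :=
    fun b hb u hu => by simpa using hW b⁻¹ (G.inv_mem hb) u hu
  refine altProj_eq_of_mem W (hW' a ha _ (altProj_mem W w)) ?_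
  intro u hu
  have hu' := hW' a⁻¹ (G.inv_mem ha) u hu
  have h := sub_altProj_mem W w _ hu'
  have h2 := altInner_comp_orthGroup a
    (u.compContinuousLinearMap ((a⁻¹ : OrthGroup q) : Eucl q →L[ℝ] Eucl q)) (w - altProj W w)
  have h3 : (u.compContinuousLinearMap ((a⁻¹ : OrthGroup q) :
      Eucl q →L[ℝ] Eucl q)).compContinuousLinearMap (a : Eucl q →L[ℝ] Eucl q) = u := by
    ext v
    simp only [compContinuousLinearMap_apply, Function.comp_def, orthGroup_inv_apply]
  rw [h3] at h2
  exact h2.trans h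

theorem hasDerivAt_exp_smul (X : Eucl q →L[ℝ] Eucl q) :
    HasDerivAt (fun t : ℝ => NormedSpace.exp (t • X)) X 0 := by
  simpa [zero_smul ℝ X] using hasDerivAt_exp_smul_const (𝕂 := ℝ) X 0

theorem hasDerivAt_comp_exp (X : Eucl q →L[ℝ] Eucl q) (w : Alt q k) :
    HasDerivAt (fun t : ℝ => w.compContinuousLinearMap (NormedSpace.exp (t • X)))
      (infAct X w) 0 := by
  have h := (hasFDerivAt_const w (0 : ℝ)).continuousAlternatingMapCompContinuousLinearMap
    (hasDerivAt_exp_smul X).hasFDerivAt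
  have h2 := h.hasDerivAt
  simpa [infAct_eq, ContinuousLinearMap.one_def, zero_smul ℝ X] using h2

/-- Differentiate the equivariance along the one-parameter group of `X` at time zero. -/
theorem IsEquivariant.map_infAct {T : Alt q k →ₗ[ℝ] Alt q l} (hT : IsEquivariant G T)
    {X : Eucl q →L[ℝ] Eucl q} (hX : X ∈ lieAlg G) (w : Alt q k) :
    T (infAct X w) = infAct X (T w) := by
  have h1 := (T.toContinuousLinearMap.hasFDerivAt).comp_hasDerivAt 0 (hasDerivAt_comp_exp X w)
  refine h1.unique ((hasDerivAt_comp_exp X (T w)).congr_of_eventuallyEq ?_)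
  refine Filter.Eventually.of_forall fun t => ?_
  obtain ⟨a, ha, hat⟩ := hX t
  simp only [Function.comp_apply, LinearMap.coe_toContinuousLinearMap', ← hat]
  exact hT a ha w

/-- Differentiate `⟨exp(tX) u, exp(tX) v⟩ = ⟨u, v⟩` at `t = 0`. -/
theorem isSkew_of_mem_lieAlg {X : Eucl q →L[ℝ] Eucl q} (hX : X ∈ lieAlg G) : IsSkew X := by
  intro u v
  have h1 : ∀ u, HasDerivAt (fun t : ℝ => NormedSpace.exp (t • X) u) (X u) 0 := fun u =>
    (ContinuousLinearMap.apply ℝ (Eucl q) u).hasFDerivAt.comp_hasDerivAt 0 (hasDerivAt_exp_smul X)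
  have h2 := (h1 u).inner ℝ (h1 v)
  have h3 : HasDerivAt (fun _ : ℝ => (inner ℝ u v : ℝ)) 0 0 := hasDerivAt_const _ _
  have h4 := h2.unique (h3.congr_of_eventuallyEq (Filter.Eventually.of_forall fun t => by
    obtain ⟨a, -, hat⟩ := hX t
    simp only [← hat]
    exact orthGroup_inner a u v))
  simp only [zero_smul ℝ X, NormedSpace.exp_zero, one_apply_eq_self] at h4
  linarith

end Equivariance

/-! ### Calculus in a transverse moving frame -/

section MovingFrame

set_option maxSynthPendingDepth 3

/-- A transverse moving coframe `θ : E → Hom(E, ℝ^q)` on an open subset of `E`, with a right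
inverse, and a torsion-free metric connection `ω = Ω ∘ θ` whose coefficients `Ω` are constant
along the kernel of `θ`. -/
structure MovingFrame (E : Type*) [NormedAddCommGroup E] [NormedSpace ℝ E] (q : ℕ) where
  dom : Set E
  isOpen_dom : IsOpen dom
  coframe : E → E →L[ℝ] Eucl q
  frame : E → Eucl q →L[ℝ] E
  conn : E → Eucl q →L[ℝ] Eucl q →L[ℝ] Eucl q
  contDiffOn_coframe : ContDiffOn ℝ ∞ coframe dom
  contDiffOn_frame : ContDiffOn ℝ ∞ frame dom
  contDiffOn_conn : ContDiffOn ℝ ∞ conn dom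
  coframe_frame : ∀ y ∈ dom, ∀ a, coframe y (frame y a) = a
  fderiv_coframe : ∀ y ∈ dom, ∀ v w, fderiv ℝ coframe y v w - fderiv ℝ coframe y w v =
    -(conn y (coframe y v) (coframe y w) - conn y (coframe y w) (coframe y v))
  fderiv_conn : ∀ y ∈ dom, ∀ v, coframe y v = 0 → fderiv ℝ conn y v = 0
  isSkew_conn : ∀ y ∈ dom, ∀ a, IsSkew (conn y a)

namespace MovingFrame

variable {E : Type*} [NormedAddCommGroup E] [NormedSpace ℝ E] {q : ℕ} (θ : MovingFrame E q)
  {V W : Type*} [NormedAddCommGroup V] [NormedSpace ℝ V] [NormedAddCommGroup W] [NormedSpace ℝ W]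
  {k l : ℕ}

/-- Smooth functions that are constant along the kernel of the coframe. -/
def IsBasicFun (A : E → V) : Prop :=
  ContDiffOn ℝ ∞ A θ.dom ∧ ∀ y ∈ θ.dom, ∀ v, θ.coframe y v = 0 → fderiv ℝ A y v = 0

/-- The derivative of a function along the vectors of the frame. -/
def deriv (A : E → V) (y : E) : Eucl q →L[ℝ] V := (fderiv ℝ A y).comp (θ.frame y)

variable {θ} {A : E → V} {y : E}

theorem differentiableAt_of_contDiffOn (hA : ContDiffOn ℝ ∞ A θ.dom) (hy : y ∈ θ.dom) :
    DifferentiableAt ℝ A y :=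
  (hA.contDiffAt (θ.isOpen_dom.mem_nhds hy)).differentiableAt (by simp)

theorem IsBasicFun.differentiableAt (hA : θ.IsBasicFun A) (hy : y ∈ θ.dom) :
    DifferentiableAt ℝ A y := differentiableAt_of_contDiffOn hA.1 hy

theorem contDiffOn_fderiv (hA : ContDiffOn ℝ ∞ A θ.dom) : ContDiffOn ℝ ∞ (fderiv ℝ A) θ.dom :=
  hA.fderiv_of_isOpen θ.isOpen_dom (by simp)

/-- The vectors `v` and `frame (coframe v)` differ by an element of the kernel, along which `A` is
constant. -/
theorem IsBasicFun.fderiv_apply (hA : θ.IsBasicFun A) (hy : y ∈ θ.dom) (v : E) :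
    fderiv ℝ A y v = θ.deriv A y (θ.coframe y v) := by
  have h := hA.2 y hy (v - θ.frame y (θ.coframe y v)) (by
    rw [map_sub, θ.coframe_frame y hy, sub_self])
  rw [map_sub, sub_eq_zero] at h
  exact h

theorem isBasicFun_const (c : V) : θ.IsBasicFun (fun _ => c) :=
  ⟨contDiffOn_const, fun y _ v _ => by simp⟩

theorem isBasicFun_conn : θ.IsBasicFun θ.conn := ⟨θ.contDiffOn_conn, θ.fderiv_conn⟩

theorem contDiffOn_deriv (hA : ContDiffOn ℝ ∞ A θ.dom) : ContDiffOn ℝ ∞ (θ.deriv A) θ.dom :=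
  (contDiffOn_fderiv hA).clm_comp θ.contDiffOn_frame

theorem IsBasicFun.fderiv_fderiv (hA : θ.IsBasicFun A) (hy : y ∈ θ.dom) (v w : E) :
    fderiv ℝ (fderiv ℝ A) y v w =
      fderiv ℝ (θ.deriv A) y v (θ.coframe y w) + θ.deriv A y (fderiv ℝ θ.coframe y v w) := by
  have h : fderiv ℝ A =ᶠ[𝓝 y] fun y => (θ.deriv A y).comp (θ.coframe y) := by
    filter_upwards [θ.isOpen_dom.mem_nhds hy] with z hz
    ext v
    exact hA.fderiv_apply hz v
  rw [h.fderiv_eq, fderiv_clm_comp (differentiableAt_of_contDiffOn (contDiffOn_deriv hA.1) hy)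
    (differentiableAt_of_contDiffOn θ.contDiffOn_coframe hy)]
  simp [add_comm]

theorem fderiv_fderiv_symm (hA : ContDiffOn ℝ ∞ A θ.dom) (hy : y ∈ θ.dom) (v w : E) :
    fderiv ℝ (fderiv ℝ A) y v w = fderiv ℝ (fderiv ℝ A) y w v :=
  ((hA.contDiffAt (θ.isOpen_dom.mem_nhds hy)).isSymmSndFDerivAt
    (by simpa using WithTop.coe_le_coe.2 (le_top : (2 : ℕ∞) ≤ ⊤))) v w

/-- Second derivatives are symmetric, and the torsion equation makes `dθ(v, ·)` vanish for `v` in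
the kernel of `θ`; so differentiating along the frame preserves constancy along the leaves. -/
theorem IsBasicFun.deriv (hA : θ.IsBasicFun A) : θ.IsBasicFun (θ.deriv A) := by
  refine ⟨contDiffOn_deriv hA.1, fun y hy v hv => ?_⟩
  ext a
  have h := fderiv_fderiv_symm hA.1 hy v (θ.frame y a)
  rw [hA.fderiv_fderiv hy, hA.fderiv_fderiv hy, hv, map_zero, θ.coframe_frame y hy, zero_add,
    ← sub_eq_zero, add_sub_assoc, ← map_sub, θ.fderiv_coframe y hy, hv] at h
  simpa using h

/-- The commutator of the derivatives along the frame. -/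
theorem IsBasicFun.deriv_deriv_sub (hA : θ.IsBasicFun A) (hy : y ∈ θ.dom) (a b : Eucl q) :
    θ.deriv (θ.deriv A) y a b - θ.deriv (θ.deriv A) y b a =
      θ.deriv A y (θ.conn y a b - θ.conn y b a) := by
  have h := fderiv_fderiv_symm hA.1 hy (θ.frame y a) (θ.frame y b)
  have h2 := θ.fderiv_coframe y hy (θ.frame y a) (θ.frame y b)
  rw [hA.fderiv_fderiv hy, hA.fderiv_fderiv hy] at h
  simp only [θ.coframe_frame y hy] at h h2
  have h3 : θ.conn y a b - θ.conn y b a = -(fderiv ℝ θ.coframe y (θ.frame y a) (θ.frame y b) -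
      fderiv ℝ θ.coframe y (θ.frame y b) (θ.frame y a)) := by rw [h2, neg_neg]
  rw [h3, map_neg, map_sub]
  simp only [MovingFrame.deriv, ContinuousLinearMap.comp_apply] at h ⊢
  rw [neg_sub, sub_eq_sub_iff_add_eq_add, h, add_comm]

theorem IsBasicFun.clm_apply (L : V →L[ℝ] W) (hA : θ.IsBasicFun A) :
    θ.IsBasicFun (fun y => L (A y)) := by
  refine ⟨L.contDiff.comp_contDiffOn hA.1, fun y hy v hv => ?_⟩
  have := (L.hasFDerivAt.comp y (hA.differentiableAt hy).hasFDerivAt).fderiv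
  simp only [Function.comp_def] at this
  rw [this, ContinuousLinearMap.comp_apply, hA.2 y hy v hv, map_zero]

theorem deriv_clm_apply (L : V →L[ℝ] W) (hA : DifferentiableAt ℝ A y) :
    θ.deriv (fun y => L (A y)) y = L.comp (θ.deriv A y) := by
  have := (L.hasFDerivAt.comp y hA.hasFDerivAt).fderiv
  simp only [Function.comp_def] at this
  rw [MovingFrame.deriv, this]
  rfl

theorem IsBasicFun.sub {A' : E → V} (hA : θ.IsBasicFun A) (hA' : θ.IsBasicFun A') :
    θ.IsBasicFun (fun y => A y - A' y) := by
  refine ⟨hA.1.sub hA'.1, fun y hy v hv => ?_⟩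
  rw [fderiv_fun_sub (hA.differentiableAt hy) (hA'.differentiableAt hy), sub_apply,
    hA.2 y hy v hv, hA'.2 y hy v hv, sub_zero]

theorem IsBasicFun.add {A' : E → V} (hA : θ.IsBasicFun A) (hA' : θ.IsBasicFun A') :
    θ.IsBasicFun (fun y => A y + A' y) := by
  refine ⟨hA.1.add hA'.1, fun y hy v hv => ?_⟩
  rw [fderiv_fun_add (hA.differentiableAt hy) (hA'.differentiableAt hy), add_apply,
    hA.2 y hy v hv, hA'.2 y hy v hv, add_zero]

theorem IsBasicFun.congr {A' : E → V} (hA : θ.IsBasicFun A) (h : ∀ y ∈ θ.dom, A' y = A y) :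
    θ.IsBasicFun A' := by
  refine ⟨hA.1.congr h, fun y hy v hv => ?_⟩
  have : A' =ᶠ[𝓝 y] A := by
    filter_upwards [θ.isOpen_dom.mem_nhds hy] with z hz
    exact h z hz
  rw [this.fderiv_eq, hA.2 y hy v hv]

theorem deriv_sub {A' : E → V} (hA : DifferentiableAt ℝ A y) (hA' : DifferentiableAt ℝ A' y) :
    θ.deriv (fun y => A y - A' y) y = θ.deriv A y - θ.deriv A' y := by
  rw [MovingFrame.deriv, fderiv_fun_sub hA hA']
  rfl

variable {V' : Type*} [NormedAddCommGroup V'] [NormedSpace ℝ V'] {A' : E → V'}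

theorem IsBasicFun.clm_apply₂ (L : V →L[ℝ] V' →L[ℝ] W) (hA : θ.IsBasicFun A)
    (hA' : θ.IsBasicFun A') : θ.IsBasicFun (fun y => L (A y) (A' y)) := by
  refine ⟨(L.contDiff.comp_contDiffOn hA.1).clm_apply hA'.1, fun y hy v hv => ?_⟩
  rw [(L.hasFDerivAt_of_bilinear (hA.differentiableAt hy).hasFDerivAt
    (hA'.differentiableAt hy).hasFDerivAt).fderiv]
  simp [hA.2 y hy v hv, hA'.2 y hy v hv]

theorem deriv_clm_apply₂ (L : V →L[ℝ] V' →L[ℝ] W) (hA : DifferentiableAt ℝ A y)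
    (hA' : DifferentiableAt ℝ A' y) (a : Eucl q) :
    θ.deriv (fun y => L (A y) (A' y)) y a =
      L (A y) (θ.deriv A' y a) + L (θ.deriv A y a) (A' y) := by
  rw [MovingFrame.deriv, (L.hasFDerivAt_of_bilinear hA.hasFDerivAt hA'.hasFDerivAt).fderiv]
  simp [MovingFrame.deriv]

variable (θ)

/-- The covariant derivative of the form with coefficients `A`. -/
def nabla (A : E → Alt q k) (y : E) : Eucl q →L[ℝ] Alt q k :=
  θ.deriv A y - (infAct.flip (A y)).comp (θ.conn y)

/-- The covariant derivative of a linear map with values in alternating forms. -/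
def nablaHom (Φ : E → Eucl q →L[ℝ] Alt q k) (y : E) : Eucl q →L[ℝ] Eucl q →L[ℝ] Alt q k :=
  θ.deriv Φ y - ((ContinuousLinearMap.compL ℝ (Eucl q) (Alt q k) (Alt q k)).flip (Φ y)).comp
    (infAct.comp (θ.conn y)) -
    (ContinuousLinearMap.compL ℝ (Eucl q) (Eucl q) (Alt q k) (Φ y)).comp (θ.conn y)

/-- The curvature of the connection. -/
def curvature (y : E) (a b : Eucl q) : Eucl q →L[ℝ] Eucl q :=
  θ.deriv θ.conn y a b - θ.deriv θ.conn y b a +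
    (θ.conn y a * θ.conn y b - θ.conn y b * θ.conn y a) -
    θ.conn y (θ.conn y a b - θ.conn y b a)

/-- The coefficients of the Laplacian of the form with coefficients `A`, by the Weitzenböck
formula. -/
def laplacian (A : E → Alt q k) (y : E) : Alt q k :=
  -(∑ i, θ.nablaHom (θ.nabla A) y (stdVec i) (stdVec i) + curvatureTerm (θ.curvature y) (A y))

variable {θ}

theorem nabla_apply (A : E → Alt q k) (y : E) (a : Eucl q) :
    θ.nabla A y a = θ.deriv A y a - infAct (θ.conn y a) (A y) := rfl

theorem nablaHom_apply (Φ : E → Eucl q →L[ℝ] Alt q k) (y : E) (a : Eucl q) :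
    θ.nablaHom Φ y a =
      θ.deriv Φ y a - (infAct (θ.conn y a)).comp (Φ y) - (Φ y).comp (θ.conn y a) := rfl

/-- The bilinear map underlying the zeroth order part of `nabla`. -/
def nablaAux (q k : ℕ) : Alt q k →L[ℝ] (Eucl q →L[ℝ] Eucl q →L[ℝ] Eucl q) →L[ℝ]
    Eucl q →L[ℝ] Alt q k :=
  (ContinuousLinearMap.compL ℝ (Eucl q) (Eucl q →L[ℝ] Eucl q) (Alt q k)).comp infAct.flip

theorem nablaAux_apply (w : Alt q k) (Ω : Eucl q →L[ℝ] Eucl q →L[ℝ] Eucl q) (a : Eucl q) :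
    nablaAux q k w Ω a = infAct (Ω a) w := rfl

theorem IsBasicFun.nabla {A : E → Alt q k} (hA : θ.IsBasicFun A) : θ.IsBasicFun (θ.nabla A) :=
  hA.deriv.sub (hA.clm_apply₂ (nablaAux q k) isBasicFun_conn)

/-- An operator with constant coefficients that commutes with the values of the connection is
parallel. -/
theorem nabla_map {P : Alt q k →L[ℝ] Alt q l} {A : E → Alt q k} (hA : θ.IsBasicFun A)
    (hy : y ∈ θ.dom) (hP : ∀ a w, P (infAct (θ.conn y a) w) = infAct (θ.conn y a) (P w)) :
    θ.nabla (fun y => P (A y)) y = P.comp (θ.nabla A y) := by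
  ext a : 1
  rw [nabla_apply, deriv_clm_apply _ (hA.differentiableAt hy), ContinuousLinearMap.comp_apply,
    ContinuousLinearMap.comp_apply, nabla_apply, map_sub, hP]

theorem nablaHom_map {P : Alt q k →L[ℝ] Alt q l} {Φ : E → Eucl q →L[ℝ] Alt q k}
    (hΦ : θ.IsBasicFun Φ)
    (hy : y ∈ θ.dom) (hP : ∀ a w, P (infAct (θ.conn y a) w) = infAct (θ.conn y a) (P w)) :
    θ.nablaHom (fun y => P.comp (Φ y)) y =
      (ContinuousLinearMap.compL ℝ _ _ _ P).comp (θ.nablaHom Φ y) := by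
  ext a : 1
  have h := deriv_clm_apply (θ := θ) (ContinuousLinearMap.compL ℝ (Eucl q) _ _ P)
    (hΦ.differentiableAt hy)
  simp only [ContinuousLinearMap.compL_apply] at h
  ext b : 1
  simp only [nablaHom_apply, h, ContinuousLinearMap.comp_apply, ContinuousLinearMap.compL_apply,
    sub_apply, map_sub, hP]

theorem nabla_alternatizeUncurryFin {Φ : E → Eucl q →L[ℝ] Alt q k} (hΦ : θ.IsBasicFun Φ)
    (hy : y ∈ θ.dom) : θ.nabla (fun y => alternatizeUncurryFin (Φ y)) y =
      (alternatizeUncurryFinCLM ℝ (Eucl q) ℝ).comp (θ.nablaHom Φ y) := by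
  ext a : 1
  have h := deriv_clm_apply (θ := θ) (alternatizeUncurryFinCLM ℝ (Eucl q) ℝ)
    (hΦ.differentiableAt hy)
  simp only [alternatizeUncurryFinCLM_apply] at h
  rw [nabla_apply, h, infAct_alternatizeUncurryFin, ContinuousLinearMap.comp_apply,
    ContinuousLinearMap.comp_apply, alternatizeUncurryFinCLM_apply,
    alternatizeUncurryFinCLM_apply, ← alternatizeUncurryFin_sub, nablaHom_apply, sub_add_eq_sub_sub]

/-- The contraction is parallel because the connection is metric. -/
theorem nabla_divergence {Φ : E → Eucl q →L[ℝ] Alt q (k + 1)} (hΦ : θ.IsBasicFun Φ)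
    (hy : y ∈ θ.dom) : θ.nabla (fun y => divergence (Φ y)) y =
      divergence.comp (θ.nablaHom Φ y) := by
  ext a : 1
  rw [nabla_apply, deriv_clm_apply (θ := θ) divergence (hΦ.differentiableAt hy),
    infAct_divergence (θ.isSkew_conn y hy a), ContinuousLinearMap.comp_apply,
    ContinuousLinearMap.comp_apply, ← map_sub, nablaHom_apply, sub_add_eq_sub_sub]

/-- The Ricci identity. -/
theorem nablaHom_nabla_sub {A : E → Alt q k} (hA : θ.IsBasicFun A) (hy : y ∈ θ.dom)
    (a b : Eucl q) :
    θ.nablaHom (θ.nabla A) y a b - θ.nablaHom (θ.nabla A) y b a =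
      -infAct (θ.curvature y a b) (A y) := by
  have hd : ∀ a b, θ.deriv (θ.nabla A) y a b = θ.deriv (θ.deriv A) y a b -
      (infAct (θ.deriv θ.conn y a b) (A y) + infAct (θ.conn y b) (θ.deriv A y a)) := by
    intro a b
    have h1 := deriv_sub (θ := θ) (y := y) (hA.deriv.differentiableAt hy)
      ((hA.clm_apply₂ (nablaAux q k) isBasicFun_conn).differentiableAt hy)
    have h2 := deriv_clm_apply₂ (θ := θ) (nablaAux q k) (hA.differentiableAt hy)
      (isBasicFun_conn.differentiableAt hy) a
    have h3 : θ.deriv (θ.nabla A) y = _ := h1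
    rw [h3, sub_apply, h2, sub_apply, add_apply, nablaAux_apply, nablaAux_apply]
  -- The frame derivatives do not commute; their commutator produces the last term in the definition
  -- of `curvature`.
  have hc := hA.deriv_deriv_sub hy a b
  rw [sub_eq_iff_eq_add] at hc
  have hcomm := infAct_commutator (θ.conn y a) (θ.conn y b) (A y)
  simp only [nablaHom_apply, sub_apply, ContinuousLinearMap.comp_apply, nabla_apply, hd, hc,
    map_sub, curvature, add_apply, map_add] at hcomm ⊢
  rw [sub_eq_iff_eq_add] at hcomm
  rw [hcomm]
  abel

end MovingFrame
end MovingFrame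

/-! ### Smooth dependence of the pull-back of alternating forms on the linear map -/

section PullbackSmooth

set_option maxSynthPendingDepth 3

variable {E F V : Type*} [NormedAddCommGroup E] [NormedSpace ℝ E] [NormedAddCommGroup F]
  [NormedSpace ℝ F] [NormedAddCommGroup V] [NormedSpace ℝ V]

/-- Induction on the degree: alternating the curried form multiplies it by `k + 1`, so a pull-back
in degree `k + 1` is built by continuous linear operations from one in degree `k` and one more
factor `f`. -/
theorem contDiff_compContinuousLinearMapCLM (k : ℕ) : ContDiff ℝ ∞ fun f : E →L[ℝ] F =>
    (compContinuousLinearMapCLM f : (F [⋀^Fin k]→L[ℝ] V) →L[ℝ] E [⋀^Fin k]→L[ℝ] V) := by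
  induction k with
  | zero =>
    have : (fun f : E →L[ℝ] F => (compContinuousLinearMapCLM f :
        (F [⋀^Fin 0]→L[ℝ] V) →L[ℝ] E [⋀^Fin 0]→L[ℝ] V)) =
        fun _ => compContinuousLinearMapCLM 0 := by
      funext f
      ext w v
      exact congrArg w (Subsingleton.elim _ _)
    rw [this]
    exact contDiff_const
  | succ k ih =>
    have : (fun f : E →L[ℝ] F => (compContinuousLinearMapCLM f :
        (F [⋀^Fin (k + 1)]→L[ℝ] V) →L[ℝ] E [⋀^Fin (k + 1)]→L[ℝ] V)) =
        fun f => ((k + 1 : ℝ)⁻¹ • alternatizeUncurryFinCLM ℝ E V).comp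
          ((ContinuousLinearMap.compL ℝ E _ _ (compContinuousLinearMapCLM f)).comp
            (((ContinuousLinearMap.compL ℝ E F (F [⋀^Fin k]→L[ℝ] V)).flip f).comp
              (curryLeftLI (𝕜 := ℝ) (E := F) (F := V)).toContinuousLinearMap)) := by
      funext f
      ext1 w
      have h : ((compContinuousLinearMapCLM f : (F [⋀^Fin k]→L[ℝ] V) →L[ℝ] _).comp
          (w.curryLeft.comp f)) = (w.compContinuousLinearMap f).curryLeft := by
        ext1 v
        exact (ContinuousAlternatingMap.curryLeft_compContinuousLinearMap w f v).symm
      have h2 : w.compContinuousLinearMap f =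
        (k + 1 : ℝ)⁻¹ • alternatizeUncurryFin ((compContinuousLinearMapCLM f).comp
          (w.curryLeft.comp f)) := by
        rw [h, ContinuousAlternatingMap.alternatizeUncurryFin_curryLeft,
          eq_inv_smul_iff₀ (by positivity)]
        ext v
        simp only [ContinuousAlternatingMap.smul_apply]
        norm_cast
      exact h2
    rw [this]
    exact contDiff_const.clm_comp (((ContinuousLinearMap.contDiff _).comp ih).clm_comp
      ((ContinuousLinearMap.contDiff _).clm_comp contDiff_const))

theorem contDiffOn_compContinuousLinearMap {X : Type*} [NormedAddCommGroup X] [NormedSpace ℝ X]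
    {k : ℕ} {s : Set X} {A : X → F [⋀^Fin k]→L[ℝ] V} {f : X → E →L[ℝ] F}
    (hA : ContDiffOn ℝ ∞ A s) (hf : ContDiffOn ℝ ∞ f s) :
    ContDiffOn ℝ ∞ (fun x => (A x).compContinuousLinearMap (f x)) s :=
  ((contDiff_compContinuousLinearMapCLM (V := V) k).comp_contDiffOn hf).clm_apply hA

end PullbackSmooth

/-! ### Symmetries of the curvature and the exterior derivative in a moving frame -/

section MovingFrame

set_option maxSynthPendingDepth 3

namespace MovingFrame

variable {E : Type*} [NormedAddCommGroup E] [NormedSpace ℝ E] {q : ℕ} {θ : MovingFrame E q}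
  {k l : ℕ} {y : E}

/-- Linear conditions on the values of the connection pass to its derivatives. Skewness and
commutation with `P` thereby reach the curvature without any closure property of the set `lieAlg G`.
-/
theorem clm_deriv_conn_eq_zero {W : Type*} [NormedAddCommGroup W] [NormedSpace ℝ W]
    (L : (Eucl q →L[ℝ] Eucl q) →L[ℝ] W) (hL : ∀ y ∈ θ.dom, ∀ a, L (θ.conn y a) = 0)
    (hy : y ∈ θ.dom) (a b : Eucl q) : L (θ.deriv θ.conn y a b) = 0 := by
  have h := deriv_clm_apply (θ := θ) (y := y)
    (L.comp (ContinuousLinearMap.apply ℝ (Eucl q →L[ℝ] Eucl q) b))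
    (isBasicFun_conn.differentiableAt hy)
  have h0 : (fun y => (L.comp (ContinuousLinearMap.apply ℝ (Eucl q →L[ℝ] Eucl q) b)) (θ.conn y))
      =ᶠ[𝓝 y] fun _ => 0 := by
    filter_upwards [θ.isOpen_dom.mem_nhds hy] with z hz
    exact hL z hz b
  have h1 := DFunLike.congr_fun h a
  rw [MovingFrame.deriv, h0.fderiv_eq] at h1
  simpa using h1.symm

theorem isSkew_curvature (hy : y ∈ θ.dom) (a b : Eucl q) : IsSkew (θ.curvature y a b) := by
  have hd : ∀ a b, IsSkew (θ.deriv θ.conn y a b) := fun a b u v => by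
    have := clm_deriv_conn_eq_zero (θ := θ)
      ((innerSL ℝ v).comp (ContinuousLinearMap.apply ℝ (Eucl q) u) +
        (innerSL ℝ u).comp (ContinuousLinearMap.apply ℝ (Eucl q) v)) (fun y hy a => by
          have := θ.isSkew_conn y hy a u v
          simp only [add_apply, ContinuousLinearMap.comp_apply, ContinuousLinearMap.apply_apply,
            innerSL_apply_apply]
          rw [real_inner_comm, this, neg_add_cancel]) hy a b
    simp only [add_apply, ContinuousLinearMap.comp_apply, ContinuousLinearMap.apply_apply,
            innerSL_apply_apply] at this
    rw [real_inner_comm v]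
    linarith
  intro u v
  have hs := θ.isSkew_conn y hy
  have hc : ∀ a b, inner ℝ (θ.conn y a (θ.conn y b u)) v =
      inner ℝ u (θ.conn y b (θ.conn y a v)) := fun a b => by rw [hs, hs, neg_neg]
  simp only [curvature, sub_apply, add_apply, mul_apply_eq_comp, inner_sub_left, inner_add_left,
    inner_sub_right, inner_add_right, hd a b u v, hd b a u v, hc, hs _ u v, map_sub]
  ring

/-- Each constituent of the curvature commutes with `P`: derivatives of the connection by linearity,
the bracket by `infAct_commutator`. -/
theorem map_infAct_curvature {P : Alt q k →L[ℝ] Alt q l}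
    (hP : ∀ y ∈ θ.dom, ∀ a w, P (infAct (θ.conn y a) w) = infAct (θ.conn y a) (P w))
    (hy : y ∈ θ.dom) (a b : Eucl q) (w : Alt q k) :
    P (infAct (θ.curvature y a b) w) = infAct (θ.curvature y a b) (P w) := by
  have hd : ∀ a b, P (infAct (θ.deriv θ.conn y a b) w) =
      infAct (θ.deriv θ.conn y a b) (P w) := fun a b => by
    have := clm_deriv_conn_eq_zero (θ := θ) (P.comp (infAct.flip w) - infAct.flip (P w))
      (fun y hy a => sub_eq_zero.2 (hP y hy a w)) hy a b
    exact sub_eq_zero.1 this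
  have hs := hP y hy
  have h1 := infAct_commutator (θ.conn y b) (θ.conn y a) w
  have h2 := infAct_commutator (θ.conn y b) (θ.conn y a) (P w)
  have h3 := congrArg P h1
  simp only [curvature, map_sub, map_add, sub_apply, add_apply, hs, hd] at h2 h3 ⊢
  rw [← h2, ← h3]

/-- Vanishing torsion says that `Γ = Dθ + Ω(θ)θ` is symmetric, so `Γ` drops out after alternation
and `Dθ` may be replaced by `-Ω(θ)θ`. Here `A` is only smooth, which makes the formula available for
proving that coefficients are basic. -/
theorem extDeriv_coframe_comp {A : E → Alt q k} (hA : ContDiffOn ℝ ∞ A θ.dom) (hy : y ∈ θ.dom) :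
    extDeriv (fun y => (A y).compContinuousLinearMap (θ.coframe y)) y =
      alternatizeUncurryFin ((compContinuousLinearMapCLM (θ.coframe y)).comp
        (fderiv ℝ A y - ((infAct.flip (A y)).comp (θ.conn y)).comp (θ.coframe y))) := by
  let Γ : E →L[ℝ] E →L[ℝ] Eucl q := fderiv ℝ θ.coframe y +
    ((ContinuousLinearMap.compL ℝ E (Eucl q) (Eucl q)).flip (θ.coframe y)).comp
      ((θ.conn y).comp (θ.coframe y))
  have hΓ : ∀ v w, Γ v w = fderiv ℝ θ.coframe y v w +
    θ.conn y (θ.coframe y v) (θ.coframe y w) := fun v w => rfl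
  have hsymm : ∀ v w, Γ v w = Γ w v := fun v w => by
    have := θ.fderiv_coframe y hy v w
    rw [hΓ, hΓ, ← sub_eq_zero]
    rw [← sub_eq_zero] at this
    rw [← this]
    abel
  have h0 := ContinuousAlternatingMap.alternatizeUncurryFin_fderivCompContinuousLinearMap_eq_zero
    (A y) (θ.coframe y) hsymm
  rw [extDeriv, fderiv_continuousAlternatingMapCompContinuousLinearMap
    (differentiableAt_of_contDiffOn hA hy)
    (differentiableAt_of_contDiffOn θ.contDiffOn_coframe hy), ← sub_eq_zero]
  rw [← alternatizeUncurryFin_sub, ← h0]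
  congr 1
  ext v : 1
  have h1 : Γ v = fderiv ℝ θ.coframe y v +
    (θ.conn y (θ.coframe y v)).comp (θ.coframe y) := rfl
  simp only [sub_apply, add_apply, ContinuousLinearMap.comp_apply, h1, map_add,
    fderivCompContinuousLinearMap_comp, map_sub, ContinuousLinearMap.flip_apply]
  have h2 : ∀ w : Alt q k, compContinuousLinearMapCLM (θ.coframe y) w =
    w.compContinuousLinearMap (θ.coframe y) := fun w => rfl
  rw [h2]
  abel

theorem IsBasicFun.extDeriv_coframe_comp {A : E → Alt q k} (hA : θ.IsBasicFun A)
    (hy : y ∈ θ.dom) :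
    extDeriv (fun y => (A y).compContinuousLinearMap (θ.coframe y)) y =
      (alternatizeUncurryFin (θ.nabla A y)).compContinuousLinearMap (θ.coframe y) := by
  rw [MovingFrame.extDeriv_coframe_comp hA.1 hy]
  ext v
  simp only [alternatizeUncurryFin_apply, compContinuousLinearMap_apply]
  refine Finset.sum_congr rfl fun i _ => congrArg _ ?_
  rw [ContinuousLinearMap.comp_apply, sub_apply, hA.fderiv_apply hy]
  rfl

theorem compContinuousLinearMap_coframe_injective (hy : y ∈ θ.dom) {w w' : Alt q k}
    (h : w.compContinuousLinearMap (θ.coframe y) = w'.compContinuousLinearMap (θ.coframe y)) :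
    w = w' := by
  ext v
  have := congrArg (fun f : E [⋀^Fin k]→L[ℝ] ℝ => f (fun i => θ.frame y (v i))) h
  simpa [compContinuousLinearMap_apply, Function.comp_def, θ.coframe_frame y hy] using this

/-- The function `A` is constant along the kernel of the coframe if `A ∘ θ` has an exterior
derivative that vanishes on this kernel. -/
theorem isBasicFun_of_extDeriv {A : E → Alt q k} (hA : ContDiffOn ℝ ∞ A θ.dom)
    (h : ∀ y ∈ θ.dom, ∀ v : Fin (k + 1) → E, θ.coframe y (v 0) = 0 →
      extDeriv (fun y => (A y).compContinuousLinearMap (θ.coframe y)) y v = 0) :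
    θ.IsBasicFun A := by
  refine ⟨hA, fun y hy v hv => ?_⟩
  ext a
  -- With one vector in the kernel and the others in the frame, only the derivative of `A` along `v`
  -- survives the alternation.
  have := h y hy (Fin.cons v fun i => θ.frame y (a i)) (by simpa using hv)
  rw [extDeriv_coframe_comp hA hy, alternatizeUncurryFin_apply, Fin.sum_univ_succ,
    Finset.sum_eq_zero, add_zero] at this
  · simpa [hv, Fin.removeNth_apply, compContinuousLinearMap_apply, Function.comp_def,
      θ.coframe_frame y hy] using this
  · intro i _
    cases k with
    | zero => exact i.elim0
    | succ k =>
      rw [ContinuousLinearMap.comp_apply]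
      have h2 : ∀ w : Alt q (k + 1), compContinuousLinearMapCLM (θ.coframe y) w
          (i.succ.removeNth (Fin.cons v fun i => θ.frame y (a i) : Fin (k + 2) → E)) = 0 :=
        fun w => w.map_coord_zero 0 (by simpa [Fin.removeNth_apply] using hv)
      rw [h2, smul_zero]

theorem curvature_swap (a b : Eucl q) : θ.curvature y a b = -θ.curvature y b a := by
  simp only [curvature, map_sub]
  abel

/-- The first Bianchi identity. -/
theorem bianchi (hy : y ∈ θ.dom) (a b c : Eucl q) :
    θ.curvature y a b c + θ.curvature y b c a + θ.curvature y c a b = 0 := by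
  refine ext_inner_left ℝ fun e => ?_
  rw [inner_zero_right]
  -- The identity is `d² = 0` for the component `⟨e, θ⟩` of the coframe, a form with constant
  -- coefficients.
  let w : Alt q 1 := ContinuousAlternatingMap.ofSubsingleton ℝ (Eucl q) ℝ (0 : Fin 1) (innerSL ℝ e)
  have hw : ∀ v, w v = inner ℝ e (v 0) := fun v => rfl
  have hA : θ.IsBasicFun (fun _ => w) := isBasicFun_const w
  have hB : θ.IsBasicFun (fun y => alternatizeUncurryFin (θ.nabla (fun _ => w) y)) :=
    hA.nabla.clm_apply (alternatizeUncurryFinCLM ℝ (Eucl q) ℝ)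
  have h0 : extDeriv (extDeriv fun y => w.compContinuousLinearMap (θ.coframe y)) y = 0 := by
    refine extDeriv_extDeriv_apply (r := ∞) ?_ (by
      simpa using WithTop.coe_le_coe.2 (le_top : (2 : ℕ∞) ≤ ⊤))
    exact (contDiffOn_compContinuousLinearMap contDiffOn_const
      θ.contDiffOn_coframe).contDiffAt (θ.isOpen_dom.mem_nhds hy)
  have h1 : (extDeriv fun y => w.compContinuousLinearMap (θ.coframe y)) =ᶠ[𝓝 y]
      fun y => (alternatizeUncurryFin (θ.nabla (fun _ => w) y)).compContinuousLinearMap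
        (θ.coframe y) := by
    filter_upwards [θ.isOpen_dom.mem_nhds hy] with z hz
    exact hA.extDeriv_coframe_comp hz
  rw [h1.extDeriv_eq, hB.extDeriv_coframe_comp hy,
    nabla_alternatizeUncurryFin hA.nabla hy] at h0
  have h2 := compContinuousLinearMap_coframe_injective (w' := 0) hy (h0.trans (by ext; simp))
  have h3 := congrArg (fun f : Alt q 3 => f ![a, b, c]) h2
  -- The double alternation is a sum of antisymmetrized second covariant derivatives, which the
  -- Ricci identity turns into three curvature terms.
  simp only [ContinuousAlternatingMap.alternatizeUncurryFin_alternatizeUncurryFinCLM_comp_apply,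
    ← ContinuousAlternatingMap.sub_apply, nablaHom_nabla_sub hA hy] at h3
  have hact : ∀ (X : Eucl q →L[ℝ] Eucl q) (v : Fin 1 → Eucl q),
      infAct X w v = inner ℝ e (X (v 0)) := fun X v => by
    simp [infAct_apply, hw]
  simp only [ContinuousAlternatingMap.neg_apply, hact] at h3
  have hsum : ∀ f : Fin 2 → Fin 2 → ℝ, ∑ i, ∑ j ≥ i, f i j = f 0 0 + f 0 1 + f 1 1 := fun f => by
    have e0 : Finset.Ici (0 : Fin 2) = {0, 1} := by decide
    have e1 : Finset.Ici (1 : Fin 2) = {1} := by decide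
    rw [Fin.sum_univ_two, e0, e1, Finset.sum_pair (by decide), Finset.sum_singleton]
  replace h3 := (hsum _).symm.trans h3
  simp [Fin.removeNth_apply] at h3
  rw [curvature_swap a c] at h3
  simp only [inner_add_right]
  simp only [neg_apply, inner_neg_right] at h3
  linarith

theorem curvature_pair_symm (hy : y ∈ θ.dom) (a b c d : Eucl q) :
    inner ℝ c (θ.curvature y a b d) = inner ℝ a (θ.curvature y c d b) := by
  have h12 : ∀ a b c d, inner ℝ d (θ.curvature y a b c) = -inner ℝ d (θ.curvature y b a c) :=
    fun a b c d => by rw [curvature_swap a b, neg_apply, inner_neg_right]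
  have h34 : ∀ a b c d, inner ℝ d (θ.curvature y a b c) = -inner ℝ c (θ.curvature y a b d) :=
    fun a b c d => by rw [real_inner_comm, isSkew_curvature hy a b c d]
  have h := pair_symm_of_bianchi (fun a b c d => inner ℝ d (θ.curvature y a b c)) h12 h34
    (fun a b c d => by
      rw [← inner_add_right, ← inner_add_right]
      simp [bianchi hy]) a b d c
  rw [h, h12, h34, neg_neg]

/-- In Weitzenböck form, the second-order part commutes with `P` because `P` is parallel, and the
curvature part by pair symmetry. -/
theorem laplacian_map {P : Alt q k →L[ℝ] Alt q k}
    (hP : ∀ y ∈ θ.dom, ∀ a w, P (infAct (θ.conn y a) w) = infAct (θ.conn y a) (P w))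
    {A : E → Alt q k} (hA : θ.IsBasicFun A) (hy : y ∈ θ.dom) :
    θ.laplacian (fun y => P (A y)) y = P (θ.laplacian A y) := by
  -- The equality is needed on a neighbourhood, since it is differentiated once more.
  have h1 : θ.nabla (fun y => P (A y)) =ᶠ[𝓝 y] fun y => P.comp (θ.nabla A y) := by
    filter_upwards [θ.isOpen_dom.mem_nhds hy] with z hz
    exact nabla_map hA hz (hP z hz)
  have h2 : θ.nablaHom (θ.nabla fun y => P (A y)) y =
      θ.nablaHom (fun y => P.comp (θ.nabla A y)) y := by
    simp only [nablaHom, MovingFrame.deriv, h1.fderiv_eq, h1.eq_of_nhds]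
  rw [laplacian, laplacian, h2, nablaHom_map hA.nabla hy (hP y hy), map_neg, map_add, map_sum,
    curvatureTerm_comm P (θ.curvature y) (fun i j a b => curvature_pair_symm hy _ _ _ _)
      (fun a b w => map_infAct_curvature hP hy a b w)]
  rfl

end MovingFrame
end MovingFrame

/-! ### Forms in charts -/

section Charts

variable {E : Type*} [NormedAddCommGroup E] [NormedSpace ℝ E]
  {M : Type*} [TopologicalSpace M] [ChartedSpace E M] 
  {V : Type*} [NormedAddCommGroup V] [NormedSpace ℝ V] {k : ℕ}

/-- The derivative of the chart around `x₀`. -/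
def chartDeriv (x₀ x : M) : E →L[ℝ] E :=
  mfderiv 𝓘(ℝ, E) 𝓘(ℝ, E) (extChartAt 𝓘(ℝ, E) x₀) x

/-- The derivative of the inverse of the chart around `x₀`. -/
def chartSymmDeriv (x₀ : M) (y : E) : E →L[ℝ] E :=
  mfderiv 𝓘(ℝ, E) 𝓘(ℝ, E) (extChartAt 𝓘(ℝ, E) x₀).symm y

/-- A form as a function on `M` with values in a fixed space. -/
def Form.toFun (α : Form E M V k) (x : M) : E [⋀^Fin k]→L[ℝ] V := α x

theorem Form.inChart_eq (α : Form E M V k) (x₀ : M) (y : E) : α.inChart x₀ y =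
    (α.toFun ((extChartAt 𝓘(ℝ, E) x₀).symm y)).compContinuousLinearMap (chartSymmDeriv x₀ y) :=
  rfl

theorem Form.d_eq (α : Form E M V k) (x : M) : α.d.toFun x =
    (extDeriv (α.inChart x) (extChartAt 𝓘(ℝ, E) x x)).compContinuousLinearMap
      (chartDeriv x x) :=
  rfl

variable [IsManifold 𝓘(ℝ, E) ∞ M]

theorem chartDeriv_comp_chartSymmDeriv {x₀ : M} {y : E}
    (hy : y ∈ (extChartAt 𝓘(ℝ, E) x₀).target) :
    (chartDeriv x₀ ((extChartAt 𝓘(ℝ, E) x₀).symm y)).comp (chartSymmDeriv x₀ y) =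
      ContinuousLinearMap.id ℝ E := by
  have : IsManifold 𝓘(ℝ, E) 1 M := .of_le (n := ∞) (by norm_cast)
  have h := mfderiv_extChartAt_comp_mfderivWithin_extChartAt_symm (I := 𝓘(ℝ, E)) hy
  simp only [modelWithCornersSelf_coe, Set.range_id, mfderivWithin_univ] at h
  exact h

theorem chartSymmDeriv_comp_chartDeriv {x₀ x : M}
    (hx : x ∈ (extChartAt 𝓘(ℝ, E) x₀).source) :
    (chartSymmDeriv x₀ (extChartAt 𝓘(ℝ, E) x₀ x)).comp (chartDeriv x₀ x) =
      ContinuousLinearMap.id ℝ E := by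
  have : IsManifold 𝓘(ℝ, E) 1 M := .of_le (n := ∞) (by norm_cast)
  have h := mfderivWithin_extChartAt_symm_comp_mfderiv_extChartAt' (I := 𝓘(ℝ, E)) hx
  simp only [modelWithCornersSelf_coe, Set.range_id, mfderivWithin_univ] at h
  exact h

/-- The exterior derivative commutes with the passage to a chart. -/
theorem Form.d_inChart (α : Form E M V k) (x₀ : M) {y : E}
    (hy : y ∈ (extChartAt 𝓘(ℝ, E) x₀).target) (hα : DifferentiableAt ℝ (α.inChart x₀) y) :
    α.d.inChart x₀ y = extDeriv (α.inChart x₀) y := by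
  have : IsManifold 𝓘(ℝ, E) 1 M := .of_le (n := ∞) (by norm_cast)
  set φ := extChartAt 𝓘(ℝ, E) x₀ with hφ
  set x := φ.symm y with hx
  set ψ := extChartAt 𝓘(ℝ, E) x with hψ
  set z := ψ x with hz
  -- `Form.d` at `x` uses the chart around `x` itself; the transition map `f` carries it to the
  -- chart around `x₀` by naturality of `extDeriv`.
  let f : E → E := φ ∘ ψ.symm
  have hxφ : x ∈ φ.source := φ.map_target hy
  have hfz : f z = y := by
    simp only [f, Function.comp_apply, hz, hψ, extChartAt_to_inv, hx]
    exact φ.right_inv hy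
  have hzψ : z ∈ ψ.target := mem_extChartAt_target x
  -- a neighbourhood of `z` on which both charts are defined
  have hnhds : ∀ᶠ z' in 𝓝 z, z' ∈ ψ.target ∧ ψ.symm z' ∈ φ.source := by
    have h1 : ψ.target ∈ 𝓝 z := extChartAt_target_mem_nhds x
    have h2 : ψ.symm ⁻¹' φ.source ∈ 𝓝 z := by
      refine (continuousAt_extChartAt_symm x).preimage_mem_nhds ?_
      rw [extChartAt_to_inv]
      exact extChartAt_source_mem_nhds' hxφ
    exact Filter.Eventually.and h1 h2
  have hfsmooth : ContDiffAt ℝ ∞ f z := by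
    have h := contDiffWithinAt_ext_coord_change (I := 𝓘(ℝ, E)) (n := ∞) x₀ x (y := z) (by
      rw [PartialEquiv.trans_source, PartialEquiv.symm_source]
      exact ⟨hzψ, hnhds.self_of_nhds.2⟩)
    simp only [modelWithCornersSelf_coe, Set.range_id, contDiffWithinAt_univ] at h
    exact h
  have hmd : ∀ z' ∈ ψ.target, MDifferentiableAt 𝓘(ℝ, E) 𝓘(ℝ, E) ψ.symm z' := fun z' hz' => by
    have h := mdifferentiableWithinAt_extChartAt_symm (I := 𝓘(ℝ, E)) hz'
    simp only [modelWithCornersSelf_coe, Set.range_id, mdifferentiableWithinAt_univ] at h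
    exact h
  have hmd0 : ∀ x' ∈ φ.source, MDifferentiableAt 𝓘(ℝ, E) 𝓘(ℝ, E) φ x' := fun x' hx' =>
    mdifferentiableAt_extChartAt (by simpa [hφ, extChartAt_source] using hx')
  have hderiv : ∀ᶠ z' in 𝓝 z, fderiv ℝ f z' =
      (chartDeriv x₀ (ψ.symm z')).comp (chartSymmDeriv x z') := by
    filter_upwards [hnhds] with z' hz'
    rw [← mfderiv_eq_fderiv]
    exact mfderiv_comp z' (hmd0 _ hz'.2) (hmd _ hz'.1)
  have hpull : α.inChart x =ᶠ[𝓝 z] fun z' =>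
      (α.inChart x₀ (f z')).compContinuousLinearMap (fderiv ℝ f z') := by
    filter_upwards [hnhds, hderiv] with z' hz' hd
    rw [hd, α.inChart_eq, α.inChart_eq]
    have h1 : φ.symm (f z') = ψ.symm z' := φ.left_inv hz'.2
    rw [← hφ, ← hψ, h1]
    have h2 := chartSymmDeriv_comp_chartDeriv hz'.2
    ext v
    simp only [compContinuousLinearMap_apply]
    refine congrArg _ (funext fun i => ?_)
    exact (DFunLike.congr_fun h2 (chartSymmDeriv x z' (v i))).symm
  have hd := hpull.extDeriv_eq
  rw [extDeriv_pullback (r := ∞) (by rw [hfz]; exact hα) hfsmooth (by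
    simpa using WithTop.coe_le_coe.2 (le_top : (2 : ℕ∞) ≤ ⊤)), hfz] at hd
  rw [α.d.inChart_eq, ← hφ, ← hx, α.d_eq, ← hψ, ← hz, hd, hderiv.self_of_nhds]
  have h1 : ψ.symm z = x := extChartAt_to_inv x
  rw [h1]
  have h2 := chartSymmDeriv_comp_chartDeriv (mem_extChartAt_source (I := 𝓘(ℝ, E)) x)
  have h3 := chartDeriv_comp_chartSymmDeriv hy
  ext v
  simp only [compContinuousLinearMap_apply]
  refine congrArg _ (funext fun i => ?_)
  have h4 := DFunLike.congr_fun h2 (chartSymmDeriv x₀ y (v i))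
  have h5 := DFunLike.congr_fun h3 (v i)
  simp only [ContinuousLinearMap.comp_apply, ContinuousLinearMap.id_apply] at h4 h5
  simp only [Function.comp_apply, ContinuousLinearMap.comp_apply, ← hψ, ← hz, ← hφ, ← hx] at h4 h5 ⊢
  rw [h4, h5]

end Charts

/-! ### The Laplacian in a moving frame -/

section MovingFrame

set_option maxSynthPendingDepth 3

theorem alt_subsingleton {q k : ℕ} (h : q < k) : Subsingleton (Alt q k) := by
  refine ⟨fun w w' => alt_ext fun I => ?_⟩
  obtain ⟨i, j, hij, hne⟩ : ∃ i j, I i = I j ∧ i ≠ j := by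
    by_contra! hI
    have := Fintype.card_le_of_injective I fun i j hij => hI i j hij
    simp at this
    omega
  rw [w.map_eq_zero_of_eq _ (by simp [hij]) hne, w'.map_eq_zero_of_eq _ (by simp [hij]) hne]

namespace MovingFrame

variable {E : Type*} [NormedAddCommGroup E] [NormedSpace ℝ E] {q : ℕ} {θ : MovingFrame E q}
  {k l : ℕ} {y : E}

variable (θ) in
/-- The coefficients of the exterior derivative of the form with coefficients `A`. -/
def extDerivCoeff (A : E → Alt q k) (y : E) : Alt q (k + 1) := alternatizeUncurryFin (θ.nabla A y)

variable (θ) in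
/-- The coefficients of the codifferential of the form with coefficients `A`. -/
def codiffCoeff (A : E → Alt q (k + 1)) (y : E) : Alt q k := -divergence (θ.nabla A y)

theorem IsBasicFun.extDerivCoeff {A : E → Alt q k} (hA : θ.IsBasicFun A) :
    θ.IsBasicFun (θ.extDerivCoeff A) :=
  hA.nabla.clm_apply (alternatizeUncurryFinCLM ℝ (Eucl q) ℝ)

theorem IsBasicFun.codiffCoeff {A : E → Alt q (k + 1)} (hA : θ.IsBasicFun A) :
    θ.IsBasicFun (θ.codiffCoeff A) :=
  hA.nabla.clm_apply (-divergence)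

theorem nabla_codiffCoeff {A : E → Alt q (k + 1)} (hA : θ.IsBasicFun A) (hy : y ∈ θ.dom) :
    θ.nabla (θ.codiffCoeff A) y = -divergence.comp (θ.nablaHom (θ.nabla A) y) := by
  rw [← nabla_divergence hA.nabla hy]
  ext a : 1
  have h : θ.codiffCoeff A = fun y => -divergence (θ.nabla A y) := rfl
  rw [neg_apply, nabla_apply, nabla_apply, MovingFrame.deriv, MovingFrame.deriv, h, fderiv_fun_neg,
    map_neg]
  simp only [ContinuousLinearMap.comp_apply, neg_apply]
  abel

/-- This identifies the Weitzenböck expression with `δd + dδ`, taking the second covariant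
derivative of `A` as `Q` in `weitzenboeck`. -/
theorem laplacian_succ {A : E → Alt q (k + 1)} (hA : θ.IsBasicFun A) (hy : y ∈ θ.dom) :
    θ.laplacian A y = θ.codiffCoeff (θ.extDerivCoeff A) y + θ.extDerivCoeff (θ.codiffCoeff A) y := by
  have h1 : θ.nabla (θ.extDerivCoeff A) y = _ := nabla_alternatizeUncurryFin hA.nabla hy
  rw [laplacian, ← weitzenboeck _ _ _ (nablaHom_nabla_sub hA hy), MovingFrame.codiffCoeff, h1,
    MovingFrame.extDerivCoeff, nabla_codiffCoeff hA hy, neg_add]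
  congr 1
  exact (map_neg (alternatizeUncurryFinCLM ℝ (Eucl q) ℝ) _).symm

/-- Operators act trivially in degree zero, so the curvature term disappears and only the trace
remains. -/
theorem laplacian_zero {A : E → Alt q 0} (hA : θ.IsBasicFun A) (hy : y ∈ θ.dom) :
    θ.laplacian A y = θ.codiffCoeff (θ.extDerivCoeff A) y := by
  have h1 : θ.nabla (θ.extDerivCoeff A) y = _ := nabla_alternatizeUncurryFin hA.nabla hy
  rw [laplacian, MovingFrame.codiffCoeff, h1]
  congr 1
  have h0 : curvatureTerm (θ.curvature y) (A y) = 0 := by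
    simp [curvatureTerm, infAct_degree_zero]
  rw [h0, add_zero, divergence_apply]
  refine Finset.sum_congr rfl fun i _ => ?_
  rw [ContinuousLinearMap.comp_apply, alternatizeUncurryFinCLM_apply,
    interior_alternatizeUncurryFin_zero]

/-- The codifferential in terms of the Hodge star. -/
theorem altStar_extDerivCoeff_altStar {m : ℕ} (h1 : k + 1 + m = q) (h2 : m + 1 + k = q)
    (hP : ∀ y ∈ θ.dom, ∀ a w,
      altStar h1 (infAct (θ.conn y a) w) = infAct (θ.conn y a) (altStar h1 w))
    {A : E → Alt q (k + 1)} (hA : θ.IsBasicFun A) (hy : y ∈ θ.dom) :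
    (-1 : ℝ) ^ (q * (k + 1 + 1) + 1) •
      altStar h2 (θ.extDerivCoeff (fun y => altStar h1 (A y)) y) = θ.codiffCoeff A y := by
  have h := nabla_map (P := (altStar h1).toContinuousLinearMap) hA hy (hP y hy)
  simp only [LinearMap.coe_toContinuousLinearMap'] at h
  rw [extDerivCoeff, h, altStar_alternatizeUncurryFin_altStar, smul_smul, ← pow_add, codiffCoeff,
    Odd.neg_one_pow, neg_one_smul]
  subst h1
  -- The sign in `δ_b` and the sign of the double star together have an odd exponent, whence `δ_b =
  -- -div ∇`.
  have : (k + 1 + m) * (k + 1 + 1) + 1 + k * m = (k + 1) * (k + 2) + 2 * (m * k + m) + 1 := by ring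
  rw [this]
  exact ((Nat.even_mul_succ_self (k + 1)).add (even_two_mul _)).add_one

end MovingFrame
end MovingFrame

/-! ### Moving frames of a foliated reduction -/

section LinForms

set_option maxSynthPendingDepth 3

variable {E : Type*} [NormedAddCommGroup E] [NormedSpace ℝ E]
  {M : Type*} [TopologicalSpace M] [ChartedSpace E M]
  {V : Type*} [NormedAddCommGroup V] [NormedSpace ℝ V] {k : ℕ}

theorem isOpen_chart_inter_preimage (x₀ : M) {U : Set M} (hU : IsOpen U) :
    IsOpen ((extChartAt 𝓘(ℝ, E) x₀).target ∩ (extChartAt 𝓘(ℝ, E) x₀).symm ⁻¹' U) :=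
  (continuousOn_extChartAt_symm x₀).isOpen_inter_preimage (isOpen_extChartAt_target x₀) hU

/-- The expression of a field of linear maps in the chart around `x₀`. -/
def LinForm.inChart (θ : LinForm E M V) (x₀ : M) (y : E) : E →L[ℝ] V :=
  (show E →L[ℝ] V from θ ((extChartAt 𝓘(ℝ, E) x₀).symm y)).comp (chartSymmDeriv x₀ y)

/-- Linear maps as alternating maps of degree one. -/
def altOfLinear : (E →L[ℝ] V) ≃ₗᵢ[ℝ] E [⋀^Fin 1]→L[ℝ] V :=
  ContinuousAlternatingMap.ofSubsingletonLIE (0 : Fin 1)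

theorem LinForm.toForm_inChart (θ : LinForm E M V) (x₀ : M) : θ.toForm.inChart x₀ =
    fun y => altOfLinear (θ.inChart x₀ y) := rfl

theorem LinForm.contDiffOn_inChart {θ : LinForm E M V} {U : Set M} (h : θ.toForm.SmoothOn U)
    (x₀ : M) : ContDiffOn ℝ ∞ (θ.inChart x₀)
      ((extChartAt 𝓘(ℝ, E) x₀).target ∩ (extChartAt 𝓘(ℝ, E) x₀).symm ⁻¹' U) := by
  have h1 := h x₀
  rw [LinForm.toForm_inChart] at h1
  exact (altOfLinear (E := E) (V := V)).toContinuousLinearEquiv.comp_contDiffOn_iff.1 h1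

variable [IsManifold 𝓘(ℝ, E) ∞ M]

theorem LinForm.d_inChart_apply {θ : LinForm E M V} {U : Set M} (hU : IsOpen U)
    (h : θ.toForm.SmoothOn U) {x₀ : M} {y : E} (hy : y ∈ (extChartAt 𝓘(ℝ, E) x₀).target)
    (hyU : (extChartAt 𝓘(ℝ, E) x₀).symm y ∈ U) (v w : E) :
    θ.toForm.d.inChart x₀ y ![v, w] =
      fderiv ℝ (θ.inChart x₀) y v w - fderiv ℝ (θ.inChart x₀) y w v := by
  have hd : DifferentiableAt ℝ (θ.inChart x₀) y :=
    ((contDiffOn_inChart h x₀).contDiffAt ((isOpen_chart_inter_preimage x₀ hU).mem_nhds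
      ⟨hy, hyU⟩)).differentiableAt (by simp)
  let L : (E →L[ℝ] V) →L[ℝ] E [⋀^Fin 1]→L[ℝ] V :=
    (altOfLinear (E := E) (V := V)).toContinuousLinearEquiv.toContinuousLinearMap
  have h2 : HasFDerivAt (θ.toForm.inChart x₀) (L.comp (fderiv ℝ (θ.inChart x₀) y)) y :=
    L.hasFDerivAt.comp y hd.hasFDerivAt
  rw [θ.toForm.d_inChart x₀ hy h2.differentiableAt, extDeriv, alternatizeUncurryFin_apply,
    h2.fderiv, Fin.sum_univ_two]
  have h3 : ∀ (f : E →L[ℝ] V) (u : Fin 1 → E), L f u = f (u 0) := fun f u => rfl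
  simp [h3, Fin.removeNth_apply, sub_eq_add_neg]

end LinForms

/-! ### Existence of moving frames adapted to the reduction -/

section Frames

set_option maxSynthPendingDepth 3

variable {E : Type*} [NormedAddCommGroup E] [NormedSpace ℝ E]
  {M : Type*} [TopologicalSpace M] [ChartedSpace E M] {q : ℕ}
  {F : Foliation E M q} {G : Subgroup (OrthGroup q)}

/-- The moving frame `T` on an open subset of the chart around `x₀` is a local section of `B`,
and its connection has values in the Lie algebra of `G`. -/
structure FoliatedReduction.IsFrame (B : FoliatedReduction F G) (x₀ : M) (T : MovingFrame E q) :
    Prop where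
  dom_subset : T.dom ⊆ (extChartAt 𝓘(ℝ, E) x₀).target
  coframe_mem : ∀ y ∈ T.dom, (T.coframe y).comp (chartDeriv x₀ ((extChartAt 𝓘(ℝ, E) x₀).symm y)) ∈
    B.coframes ((extChartAt 𝓘(ℝ, E) x₀).symm y)
  conn_mem : ∀ y ∈ T.dom, ∀ a, T.conn y a ∈ lieAlg G

variable [IsManifold 𝓘(ℝ, E) ∞ M]

/-- A foliated section of `B` supplies the coframe. Its connection form is basic, so it factors
through the coframe, and the coefficients are constant along the leaves by the torsion equation. -/
theorem FoliatedReduction.exists_isFrame (B : FoliatedReduction F G)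
    {D : B.FoliatedConnection} (hD : D.IsTorsionFree) (x₀ : M) {y₀ : E}
    (hy₀ : y₀ ∈ (extChartAt 𝓘(ℝ, E) x₀).target) :
    ∃ T : MovingFrame E q, y₀ ∈ T.dom ∧ B.IsFrame x₀ T := by
  set φ := extChartAt 𝓘(ℝ, E) x₀ with hφ
  obtain ⟨U, hU, hxU, θ, hθ, hθB⟩ := B.exists_section (φ.symm y₀)
  have hsec : B.IsSectionOn θ U := ⟨hθ.1, hθB⟩
  have hη := D.foliated U hU θ hsec hθ
  set S : Set E := φ.target ∩ φ.symm ⁻¹' U with hS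
  have hSo : IsOpen S := isOpen_chart_inter_preimage x₀ hU
  have hy₀S : y₀ ∈ S := ⟨hy₀, hxU⟩
  set t : E → E →L[ℝ] Eucl q := θ.inChart x₀ with ht
  set η : E → E →L[ℝ] Eucl q →L[ℝ] Eucl q := (D.form θ).inChart x₀ with hηdef
  have htc : ContDiffOn ℝ ∞ t S := LinForm.contDiffOn_inChart hθ.1 x₀
  have hηc : ContDiffOn ℝ ∞ η S := LinForm.contDiffOn_inChart hη.1 x₀
  -- the chart and its inverse
  have hinv : ∀ y ∈ S, (chartSymmDeriv x₀ y).comp (chartDeriv x₀ (φ.symm y)) =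
      ContinuousLinearMap.id ℝ E := fun y hy => by
    have := chartSymmDeriv_comp_chartDeriv (φ.map_target hy.1)
    rwa [← hφ, φ.right_inv hy.1] at this
  have ht_eq : ∀ y ∈ S, (t y).comp (chartDeriv x₀ (φ.symm y)) = θ (φ.symm y) := fun y hy => by
    rw [ht, LinForm.inChart, ContinuousLinearMap.comp_assoc, hinv y hy]
    rfl
  have hker : ∀ y ∈ S, ∀ v, t y v = 0 → chartSymmDeriv x₀ y v ∈ F.tangent (φ.symm y) :=
    fun y hy v hv => by
      rw [← B.ker_eq _ _ (hθB _ hy.2)]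
      exact hv
  have hsurj : ∀ y ∈ S, Function.Surjective (t y) := fun y hy a => by
    obtain ⟨v, hv⟩ := B.surjective _ _ (hθB _ hy.2) a
    refine ⟨chartDeriv x₀ (φ.symm y) v, ?_⟩
    rw [← hv, ← ht_eq y hy]
    rfl
  -- a right inverse of the coframe
  obtain ⟨s, hs⟩ := (t y₀).exists_rightInverse_of_surjective
    (LinearMap.range_eq_top.2 (hsurj y₀ hy₀S))
  -- A right inverse `s` of the coframe at `y₀` remains one nearby after correction by `(t y ∘
  -- s)⁻¹`; the domain is shrunk to where this inverse exists.
  let N : E → Eucl q →L[ℝ] Eucl q := fun y => (t y).comp s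
  have hNc : ContDiffOn ℝ ∞ N S := htc.clm_comp contDiffOn_const
  set dom : Set E := S ∩ N ⁻¹' {u | IsUnit u} with hdom
  have hdomo : IsOpen dom := hNc.continuousOn.isOpen_inter_preimage hSo Units.isOpen
  have hdomS : dom ⊆ S := Set.inter_subset_left
  let r : E → Eucl q →L[ℝ] E := fun y => s.comp (Ring.inverse (N y))
  have hrc : ContDiffOn ℝ ∞ r dom := by
    refine contDiffOn_const.clm_comp fun y hy => ?_
    obtain ⟨u, hu⟩ := hy.2
    have h1 : ContDiffAt ℝ ∞ Ring.inverse (N y) := hu ▸ contDiffAt_ringInverse ℝ u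
    exact h1.comp_contDiffWithinAt y ((hNc y hy.1).mono hdomS)
  have htr : ∀ y ∈ dom, ∀ a, t y (r y a) = a := fun y hy a =>
    DFunLike.congr_fun (Ring.mul_inverse_cancel (N y) hy.2) a
  let Ω : E → Eucl q →L[ℝ] Eucl q →L[ℝ] Eucl q := fun y => (η y).comp (r y)
  have hΩc : ContDiffOn ℝ ∞ Ω dom := (hηc.mono hdomS).clm_comp hrc
  have hηΩ : ∀ y ∈ dom, ∀ v, η y v = Ω y (t y v) := fun y hy v => by
    have h1 : t y (v - r y (t y v)) = 0 := by rw [map_sub, htr y hy, sub_self]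
    have h2 : η y (v - r y (t y v)) = 0 :=
      (hη.2 _ (hdomS hy).2).1 (fun _ => chartSymmDeriv x₀ y (v - r y (t y v)))
        ⟨0, hker y (hdomS hy) _ h1⟩
    rw [map_sub, sub_eq_zero] at h2
    exact h2
  have hmem : ∀ y ∈ dom, ∀ v, η y v ∈ lieAlg G := fun y hy v =>
    D.mem_lieAlg U hU θ hsec _ (hdomS hy).2 _
  have htors : ∀ y ∈ dom, ∀ v w, fderiv ℝ t y v w - fderiv ℝ t y w v =
      -(Ω y (t y v) (t y w) - Ω y (t y w) (t y v)) := fun y hy v w => by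
    rw [← hηΩ y hy, ← hηΩ y hy, ← LinForm.d_inChart_apply hU hθ.1 (hdomS hy).1 (hdomS hy).2]
    have := hD U hU θ hsec _ (hdomS hy).2 (chartSymmDeriv x₀ y v) (chartSymmDeriv x₀ y w)
    refine Eq.trans ?_ this
    rw [Form.inChart_eq, compContinuousLinearMap_apply]
    refine congrArg _ (funext fun i => ?_)
    fin_cases i <;> rfl
  have hΩb : ∀ y ∈ dom, ∀ v, t y v = 0 → fderiv ℝ Ω y v = 0 := fun y hy v hv => by
    have hnhds := hdomo.mem_nhds hy
    have hev : η =ᶠ[𝓝 y] fun y => (Ω y).comp (t y) := by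
      filter_upwards [hnhds] with z hz
      ext1 v
      exact hηΩ z hz v
    have hder := hev.fderiv_eq (𝕜 := ℝ)
    rw [fderiv_clm_comp (𝕜 := ℝ) ((hΩc.contDiffAt hnhds).differentiableAt (by simp))
      (((htc.mono hdomS).contDiffAt hnhds).differentiableAt (by simp))] at hder
    have hder' : ∀ v w, fderiv ℝ η y v w = Ω y (fderiv ℝ t y v w) + fderiv ℝ Ω y v (t y w) :=
      fun v w => by rw [hder]; rfl
    ext1 a
    obtain ⟨w, rfl⟩ := hsurj y hy.1 a
    -- For `v` tangent to the leaves, `dη(v, w) = 0` by basicness and `dt(v, w) = 0` by the torsion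
    -- equation. Expanding `η = Ω ∘ t` leaves `DΩ(v)(t w) = 0`, and `t` is onto.
    have h1 := LinForm.d_inChart_apply hU hη.1 (hdomS hy).1 (hdomS hy).2 v w
    have h2 : (D.form θ).toForm.d.inChart x₀ y ![v, w] = 0 :=
      (hη.2 _ (hdomS hy).2).2 (fun i => chartSymmDeriv x₀ y (![v, w] i))
        ⟨0, hker y (hdomS hy) _ hv⟩
    rw [h2, ← hηdef, hder', hder', hv, map_zero, add_zero] at h1
    have h3 := congrArg (Ω y) (htors y hy v w)
    simp only [hv, map_zero, zero_apply, sub_zero, neg_zero, map_sub] at h3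
    rw [zero_apply, h1, add_sub_right_comm, h3, zero_add]
  refine ⟨⟨dom, hdomo, t, r, Ω, htc.mono hdomS, hrc, hΩc, htr, htors, hΩb,
    fun y hy a => isSkew_of_mem_lieAlg (hmem y hy _)⟩, ?_, ?_⟩
  · refine ⟨hy₀S, ?_⟩
    have : N y₀ = 1 := hs
    simp [this]
  · exact ⟨fun y hy => hy.1.1, fun y hy => (ht_eq y hy.1).symm ▸ hθB _ hy.1.2,
      fun y hy a => hmem y hy _⟩

end Frames

/-! ### Basic forms in moving frames -/

section Coefficients

set_option maxSynthPendingDepth 3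

/-- An alternating form that vanishes as soon as one argument is in `K` depends only on the
classes of its arguments modulo `K`. -/
theorem alternating_congr_of_sub_mem {E V : Type*} [NormedAddCommGroup E] [NormedSpace ℝ E]
    [NormedAddCommGroup V] [NormedSpace ℝ V] {k : ℕ} (w : E [⋀^Fin k]→L[ℝ] V) (K : Set E)
    (hw : ∀ v, (∃ i, v i ∈ K) → w v = 0) {v v' : Fin k → E} (h : ∀ i, v i - v' i ∈ K) :
    w v = w v' := by
  have key : ∀ s : Finset (Fin k), w (s.piecewise v v') = w v' := fun s => by
    induction s using Finset.induction_on with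
    | empty => simp
    | insert j s hj ih =>
      have h1 : Function.update (s.piecewise v v') j (v' j) = s.piecewise v v' := by
        rw [← Finset.piecewise_eq_of_notMem s v v' hj, Function.update_eq_self]
      have h2 := w.map_update_sub (s.piecewise v v') j (v j) (v' j)
      rw [h1] at h2
      rw [← ih, Finset.piecewise_insert, ← sub_eq_zero, ← h2]
      exact hw _ ⟨j, by simpa using h j⟩
  simpa using key Finset.univ

variable {E : Type*} [NormedAddCommGroup E] [NormedSpace ℝ E]
  {M : Type*} [TopologicalSpace M] [ChartedSpace E M] {q k l : ℕ}
  {F : Foliation E M q} {G : Subgroup (OrthGroup q)} {B : FoliatedReduction F G}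

/-- The form `α` has the coefficients `A` in the moving frame `T`. -/
def Form.HasCoeff (α : Form E M ℝ k) (x₀ : M) (T : MovingFrame E q) (A : E → Alt q k) : Prop :=
  T.IsBasicFun A ∧ ∀ y ∈ T.dom, α.inChart x₀ y = (A y).compContinuousLinearMap (T.coframe y)

variable [IsManifold 𝓘(ℝ, E) ∞ M] {α : Form E M ℝ k} {x₀ : M} {T : MovingFrame E q}
  {A : E → Alt q k} {y : E}

theorem Form.toFun_eq_inChart (α : Form E M ℝ k) (hy : y ∈ (extChartAt 𝓘(ℝ, E) x₀).target) :
    α.toFun ((extChartAt 𝓘(ℝ, E) x₀).symm y) = (α.inChart x₀ y).compContinuousLinearMap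
      (chartDeriv x₀ ((extChartAt 𝓘(ℝ, E) x₀).symm y)) := by
  have h := chartSymmDeriv_comp_chartDeriv ((extChartAt 𝓘(ℝ, E) x₀).map_target hy)
  rw [(extChartAt 𝓘(ℝ, E) x₀).right_inv hy] at h
  rw [α.inChart_eq]
  ext v
  simp only [compContinuousLinearMap_apply]
  exact congrArg _ (funext fun i => (DFunLike.congr_fun h (v i)).symm)

namespace FoliatedReduction.IsFrame

variable (hT : B.IsFrame x₀ T)
include hT

theorem toFun_eq (hα : α.HasCoeff x₀ T A) (hy : y ∈ T.dom) :
    α.toFun ((extChartAt 𝓘(ℝ, E) x₀).symm y) = (A y).compContinuousLinearMap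
      ((T.coframe y).comp (chartDeriv x₀ ((extChartAt 𝓘(ℝ, E) x₀).symm y))) := by
  rw [α.toFun_eq_inChart (hT.dom_subset hy), hα.2 y hy]
  rfl

theorem kills (hα : α.HasCoeff x₀ T A) (hy : y ∈ T.dom) :
    F.Kills α ((extChartAt 𝓘(ℝ, E) x₀).symm y) := by
  rintro v ⟨i, hi⟩
  have h1 := DFunLike.congr_fun (hT.toFun_eq hα hy) v
  refine h1.trans ((A y).map_coord_zero i ?_)
  rw [← B.ker_eq _ _ (hT.coframe_mem y hy)] at hi
  exact hi

theorem chartSymmDeriv_mem_tangent (hy : y ∈ T.dom) {v : E} (hv : T.coframe y v = 0) :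
    chartSymmDeriv x₀ y v ∈ F.tangent ((extChartAt 𝓘(ℝ, E) x₀).symm y) := by
  rw [← B.ker_eq _ _ (hT.coframe_mem y hy)]
  have h := DFunLike.congr_fun (chartDeriv_comp_chartSymmDeriv (hT.dom_subset hy)) v
  exact (congrArg (T.coframe y) h).trans hv

/-- Basic forms have coefficients. -/
theorem exists_hasCoeff (hα : F.IsBasic α) : ∃ A, α.HasCoeff x₀ T A := by
  have hsm : ContDiffOn ℝ ∞ (α.inChart x₀) T.dom :=
    (hα.1 x₀).mono fun y hy => ⟨hT.dom_subset hy, Set.mem_univ _⟩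
  -- A form killed by the leaf directions is determined by its values on the frame.
  have heq : ∀ y ∈ T.dom, α.inChart x₀ y =
      ((α.inChart x₀ y).compContinuousLinearMap (T.frame y)).compContinuousLinearMap
        (T.coframe y) := fun y hy => by
    ext v
    refine alternating_congr_of_sub_mem _ {v | T.coframe y v = 0} ?_ fun i => ?_
    · rintro v ⟨i, hi⟩
      exact (hα.2 _ (Set.mem_univ _)).1 _ ⟨i, hT.chartSymmDeriv_mem_tangent hy hi⟩
    · simp [T.coframe_frame y hy]
  refine ⟨fun y => (α.inChart x₀ y).compContinuousLinearMap (T.frame y),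
    MovingFrame.isBasicFun_of_extDeriv
      (contDiffOn_compContinuousLinearMap hsm T.contDiffOn_frame) fun y hy v hv => ?_, heq⟩
  have hev : (fun y => ((α.inChart x₀ y).compContinuousLinearMap
      (T.frame y)).compContinuousLinearMap (T.coframe y)) =ᶠ[𝓝 y] α.inChart x₀ := by
    filter_upwards [T.isOpen_dom.mem_nhds hy] with z hz
    exact (heq z hz).symm
  rw [hev.extDeriv_eq, ← α.d_inChart x₀ (hT.dom_subset hy)
    ((hsm.contDiffAt (T.isOpen_dom.mem_nhds hy)).differentiableAt (by simp))]
  exact (hα.2 _ (Set.mem_univ _)).2 _ ⟨0, hT.chartSymmDeriv_mem_tangent hy hv⟩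

theorem hasCoeff_d (hα : α.HasCoeff x₀ T A) : α.d.HasCoeff x₀ T (T.extDerivCoeff A) := by
  refine ⟨hα.1.extDerivCoeff, fun y hy => ?_⟩
  have hev : α.inChart x₀ =ᶠ[𝓝 y] fun y => (A y).compContinuousLinearMap (T.coframe y) := by
    filter_upwards [T.isOpen_dom.mem_nhds hy] with z hz
    exact hα.2 z hz
  have hd : DifferentiableAt ℝ (fun y => (A y).compContinuousLinearMap (T.coframe y)) y :=
    MovingFrame.differentiableAt_of_contDiffOn
      (contDiffOn_compContinuousLinearMap hα.1.1 T.contDiffOn_coframe) hy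
  rw [α.d_inChart x₀ (hT.dom_subset hy) (hev.differentiableAt_iff.2 hd), hev.extDeriv_eq,
    hα.1.extDeriv_coframe_comp hy]
  rfl

/-- The frame chosen in `fibrewise` differs from the moving frame by some `a` in `G`, possibly
varying irregularly with the point; equivariance cancels it. -/
theorem hasCoeff_fibrewise {P : Alt q k →ₗ[ℝ] Alt q l} (hP : IsEquivariant G P)
    (hα : α.HasCoeff x₀ T A) : (B.fibrewise P α).HasCoeff x₀ T fun y => P (A y) := by
  refine ⟨hα.1.clm_apply P.toContinuousLinearMap, fun y hy => ?_⟩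
  set x := (extChartAt 𝓘(ℝ, E) x₀).symm y with hx
  obtain ⟨a, ha, h⟩ := B.exists_smul x _ (hT.coframe_mem y hy) _ (B.coframe_mem x)
  have h1 : ((T.coframe y).comp (chartDeriv x₀ x)).comp
      (show Eucl q →L[ℝ] E from B.lift x) = ((a⁻¹ : OrthGroup q) : Eucl q →L[ℝ] Eucl q) := by
    have h2 := B.coframe_comp_lift x
    rw [h] at h2
    ext1 u
    have h3 := congrArg (((a⁻¹ : OrthGroup q) : Eucl q →L[ℝ] Eucl q)) (DFunLike.congr_fun h2 u)
    refine Eq.trans ?_ h3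
    exact (orthGroup_inv_apply a _).symm
  have h4 : (α.toFun x).compContinuousLinearMap (show Eucl q →L[ℝ] E from B.lift x) =
      (A y).compContinuousLinearMap ((a⁻¹ : OrthGroup q) : Eucl q →L[ℝ] Eucl q) := by
    rw [hT.toFun_eq hα hy, ← h1]
    rfl
  have h5 : (B.fibrewise P α).toFun x = (P ((α.toFun x).compContinuousLinearMap
      (show Eucl q →L[ℝ] E from B.lift x))).compContinuousLinearMap
        (show E →L[ℝ] Eucl q from B.coframe x) := rfl
  have h6 : (show E →L[ℝ] Eucl q from B.coframe x) =
    (a : Eucl q →L[ℝ] Eucl q).comp ((T.coframe y).comp (chartDeriv x₀ x)) := h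
  rw [Form.inChart_eq, ← hx, h5, h4, hP _ (G.inv_mem ha), h6]
  have h7 := chartDeriv_comp_chartSymmDeriv (hT.dom_subset hy)
  ext v
  simp only [compContinuousLinearMap_apply]
  refine congrArg _ (funext fun i => ?_)
  refine (orthGroup_inv_apply a _).trans ?_
  exact congrArg (T.coframe y) (DFunLike.congr_fun h7 (v i))

/-- Each factor of `⋆ d ⋆` is read on coefficients, the term with `κ = 0` being absent. -/
theorem hasCoeff_codiff (hG : IsConnected (G : Set (OrthGroup q))) {α : Form E M ℝ (k + 1)}
    {A : E → Alt q (k + 1)} (hα : α.HasCoeff x₀ T A) :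
    (B.codiff 0 α).HasCoeff x₀ T (T.codiffCoeff A) := by
  refine ⟨hα.1.codiffCoeff, fun y hy => ?_⟩
  rw [FoliatedReduction.codiff]
  split_ifs with h
  · have h1 : k + 1 + (q - (k + 1)) = q := Nat.add_sub_cancel' h
    have h2 : q - (k + 1) + 1 + k = q := by omega
    have hβ := hT.hasCoeff_d (hT.hasCoeff_fibrewise (isEquivariant_altStar hG h1) hα)
    have hγ := hT.hasCoeff_fibrewise (isEquivariant_altStar hG h2) hβ
    have hw : ∀ β : Form E M ℝ (q - (k + 1)), β.wedgeLin (0 : LinForm E M ℝ) = 0 := fun β => by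
      funext x
      exact (congrArg alternatizeUncurryFin (by ext; simp : (0 : E →L[ℝ] ℝ).smulRight
        (β.toFun x) = 0)).trans (map_zero (alternatizeUncurryFinCLM ℝ E ℝ))
    rw [← MovingFrame.altStar_extDerivCoeff_altStar h1 h2
      (fun y hy a w => (isEquivariant_altStar hG h1).map_infAct (hT.conn_mem y hy a) w) hα.1 hy]
    have h3 := hγ.2 y hy
    simp only [hw, sub_zero]
    rw [Form.inChart_eq] at h3 ⊢
    ext v
    exact congrArg _ (DFunLike.congr_fun h3 v)
  -- Above degree `q` the codifferential is zero by definition, and so are all coefficients.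
  · have := alt_subsingleton (q := q) (k := k + 1) (by omega)
    have h0 : T.codiffCoeff A y = 0 := by
      rw [MovingFrame.codiffCoeff, show T.nabla A y = 0 by ext1 a; exact Subsingleton.elim _ _,
        map_zero, neg_zero]
    rw [h0]
    rfl

theorem hasCoeff_laplacian (hG : IsConnected (G : Set (OrthGroup q))) (hα : α.HasCoeff x₀ T A) :
    (B.laplacian 0 α).HasCoeff x₀ T (T.laplacian A) := by
  cases k with
  | zero =>
    have h := hT.hasCoeff_codiff hG (hT.hasCoeff_d hα)
    exact ⟨h.1.congr fun y hy => MovingFrame.laplacian_zero hα.1 hy, fun y hy =>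
      (h.2 y hy).trans (by rw [MovingFrame.laplacian_zero hα.1 hy])⟩
  | succ k =>
    have h := hT.hasCoeff_codiff hG (hT.hasCoeff_d hα)
    have h' := hT.hasCoeff_d (hT.hasCoeff_codiff hG hα)
    refine ⟨(h.1.add h'.1).congr fun y hy => MovingFrame.laplacian_succ hα.1 hy, fun y hy => ?_⟩
    rw [MovingFrame.laplacian_succ hα.1 hy]
    exact congrArg₂ (· + ·) (h.2 y hy) (h'.2 y hy)

theorem proj_laplacian (hG : IsConnected (G : Set (OrthGroup q))) {W : Submodule ℝ (Alt q k)}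
    (hW : IsInvariant G W) (hα : α.HasCoeff x₀ T A) (hy : y ∈ T.dom) :
    (B.proj W (B.laplacian 0 α)).toFun ((extChartAt 𝓘(ℝ, E) x₀).symm y) =
      (B.laplacian 0 (B.proj W α)).toFun ((extChartAt 𝓘(ℝ, E) x₀).symm y) := by
  have hP := isEquivariant_altProj hW
  have h1 : (B.proj W (B.laplacian 0 α)).HasCoeff x₀ T _ :=
    hT.hasCoeff_fibrewise hP (hT.hasCoeff_laplacian hG hα)
  have h2 := hT.hasCoeff_laplacian hG (hT.hasCoeff_fibrewise hP hα)
  rw [hT.toFun_eq h1 hy]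
  refine Eq.trans ?_ (hT.toFun_eq h2 hy).symm
  have h3 := MovingFrame.laplacian_map (P := (altProj W).toContinuousLinearMap)
    (fun y hy a w => hP.map_infAct (hT.conn_mem y hy a) w) hα.1 hy
  simp only [LinearMap.coe_toContinuousLinearMap'] at h3
  rw [h3]

end FoliatedReduction.IsFrame

namespace FoliatedReduction

/-- Coefficients constant along the leaves give smoothness and `i_X α = 0`; as `dα` again has
coefficients, `i_X dα = 0` follows in the same way. -/
theorem isBasic_of_hasCoeff (h : ∀ (x₀ : M), ∀ y₀ ∈ (extChartAt 𝓘(ℝ, E) x₀).target,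
    ∃ T A, y₀ ∈ T.dom ∧ B.IsFrame x₀ T ∧ α.HasCoeff x₀ T A) : F.IsBasic α := by
  refine ⟨fun x₀ y₀ hy₀ => ?_, fun x _ => ?_⟩
  · obtain ⟨T, A, hyT, hT, hα⟩ := h x₀ y₀ hy₀.1
    have h1 : ContDiffOn ℝ ∞ (α.inChart x₀) T.dom :=
      (contDiffOn_compContinuousLinearMap hα.1.1 T.contDiffOn_coframe).congr hα.2
    exact (h1.contDiffAt (T.isOpen_dom.mem_nhds hyT)).contDiffWithinAt
  · obtain ⟨T, A, hyT, hT, hα⟩ := h x _ (mem_extChartAt_target x)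
    have h1 := hT.kills hα hyT
    have h2 := hT.kills (hT.hasCoeff_d hα) hyT
    rw [extChartAt_to_inv] at h1 h2
    exact ⟨h1, h2⟩

variable {D : B.FoliatedConnection} (hD : D.IsTorsionFree)
include hD

theorem exists_frame_hasCoeff (hα : F.IsBasic α) (x₀ : M) {y₀ : E}
    (hy₀ : y₀ ∈ (extChartAt 𝓘(ℝ, E) x₀).target) :
    ∃ T A, y₀ ∈ T.dom ∧ B.IsFrame x₀ T ∧ α.HasCoeff x₀ T A := by
  obtain ⟨T, hyT, hT⟩ := B.exists_isFrame hD x₀ hy₀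
  obtain ⟨A, hA⟩ := hT.exists_hasCoeff hα
  exact ⟨T, A, hyT, hT, hA⟩

theorem isBasic_proj {W : Submodule ℝ (Alt q k)} (hW : IsInvariant G W) (hα : F.IsBasic α) :
    F.IsBasic (B.proj W α) :=
  isBasic_of_hasCoeff (B := B) fun x₀ _ hy₀ =>
    let ⟨T, _, hyT, hT, hA⟩ := exists_frame_hasCoeff hD hα x₀ hy₀
    ⟨T, _, hyT, hT, hT.hasCoeff_fibrewise (isEquivariant_altProj hW) hA⟩

theorem isBasic_laplacian (hG : IsConnected (G : Set (OrthGroup q))) (hα : F.IsBasic α) :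
    F.IsBasic (B.laplacian 0 α) :=
  isBasic_of_hasCoeff (B := B) fun x₀ _ hy₀ =>
    let ⟨T, _, hyT, hT, hA⟩ := exists_frame_hasCoeff hD hα x₀ hy₀
    ⟨T, _, hyT, hT, hT.hasCoeff_laplacian hG hA⟩

theorem proj_laplacian (hG : IsConnected (G : Set (OrthGroup q))) {W : Submodule ℝ (Alt q k)}
    (hW : IsInvariant G W) (hα : F.IsBasic α) :
    B.proj W (B.laplacian 0 α) = B.laplacian 0 (B.proj W α) := by
  funext x
  obtain ⟨T, A, hyT, hT, hA⟩ := exists_frame_hasCoeff hD hα x (mem_extChartAt_target x)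
  have h := hT.proj_laplacian hG hW hA hyT
  rw [extChartAt_to_inv] at h
  exact h

end FoliatedReduction
end Coefficients

/-! ### Forms of type `W` as the forms fixed by the projection -/

section OfType

variable {E : Type*} [NormedAddCommGroup E] [NormedSpace ℝ E]
  {M : Type*} [TopologicalSpace M] [ChartedSpace E M] {q k : ℕ}
  {F : Foliation E M q} {G : Subgroup (OrthGroup q)} {B : FoliatedReduction F G}
  {W : Submodule ℝ (Alt q k)} {α : Form E M ℝ k}

namespace FoliatedReduction

theorem proj_zero (B : FoliatedReduction F G) (W : Submodule ℝ (Alt q k)) :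
    B.proj W (0 : Form E M ℝ k) = 0 := by
  funext x
  change (altProj W (0 : Alt q k)).compContinuousLinearMap _ = 0
  rw [map_zero]
  rfl

theorem IsOfType.proj_eq (hα : B.IsOfType W α) : B.proj W α = α := by
  funext x
  obtain ⟨w, hw, h⟩ := hα x _ (B.coframe_mem x)
  have h1 : (α x).compContinuousLinearMap (B.lift x) = w := by
    rw [h]
    ext v
    exact congrArg w (funext fun i => DFunLike.congr_fun (B.coframe_comp_lift x) (v i))
  change (altProj W ((α x).compContinuousLinearMap (B.lift x))).compContinuousLinearMap _ = _
  rw [h1, altProj_eq_of_mem W hw (by rw [sub_self]; exact Submodule.zero_mem _), h]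

/-- By construction the value lies in `W` in the chosen frame; invariance of `W` carries this to all
frames in the fibre. -/
theorem isOfType_proj (hW : IsInvariant G W) (α : Form E M ℝ k) :
    B.IsOfType W (B.proj W α) := by
  intro x θ hθ
  obtain ⟨a, ha, h⟩ := B.exists_smul x θ hθ _ (B.coframe_mem x)
  have hmem := hW a⁻¹ (G.inv_mem ha) _
    (altProj_mem W ((α x).compContinuousLinearMap (B.lift x)))
  rw [inv_inv] at hmem
  refine ⟨_, hmem, ?_⟩
  change (altProj W _).compContinuousLinearMap (B.coframe x) = _
  rw [h]
  rfl

end FoliatedReduction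
end OfType

end FoliatedHodge

end

/-! ### The theorem -/

theorem mainTheorem6 {E : Type*} [NormedAddCommGroup E] [NormedSpace ℝ E] [FiniteDimensional ℝ E]
    {M : Type*} [TopologicalSpace M] [ChartedSpace E M] [IsManifold 𝓘(ℝ, E) ∞ M]
    [T2Space M] [CompactSpace M] {q : ℕ}
    (F : FoliatedHodge.Foliation E M q) (g : FoliatedHodge.Metric E M)
    (hg : F.IsBundleLike g) (hmin : F.HasMinimalLeaves g)
    (G : Subgroup (FoliatedHodge.OrthGroup q))
    (hG : IsConnected (G : Set (FoliatedHodge.OrthGroup q)))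
    (B : FoliatedHodge.FoliatedReduction F G) (hB : B.IsOrthonormal g)
    (hD : ∃ D : B.FoliatedConnection, D.IsTorsionFree) (k : ℕ) :
    (∀ W : Submodule ℝ (FoliatedHodge.Alt q k), FoliatedHodge.IsInvariant G W →
      ∀ α : FoliatedHodge.Form E M ℝ k, F.IsBasic α →
        F.IsBasic (B.proj W α) ∧
        F.IsBasic (B.laplacian (F.meanCurvatureForm g) α) ∧
        B.proj W (B.laplacian (F.meanCurvatureForm g) α) =
          B.laplacian (F.meanCurvatureForm g) (B.proj W α)) ∧
    (∀ (s : ℕ) (W : Fin s → Submodule ℝ (FoliatedHodge.Alt q k)),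
      (∀ i, FoliatedHodge.IsIrreducibleInvariant G (W i)) →
      ∀ α : FoliatedHodge.Form E M ℝ k, F.IsBasic α →
        B.laplacian (F.meanCurvatureForm g) α = 0 →
        ∀ i, F.IsBasic (B.proj (W i) α) ∧
          B.laplacian (F.meanCurvatureForm g) (B.proj (W i) α) = 0) ∧
    (∀ W : Submodule ℝ (FoliatedHodge.Alt q k), FoliatedHodge.IsInvariant G W →
      ∀ α : FoliatedHodge.Form E M ℝ k, F.IsBasic α → B.IsOfType W α →
        F.IsBasic (B.laplacian (F.meanCurvatureForm g) α) ∧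
        B.IsOfType W (B.laplacian (F.meanCurvatureForm g) α)) := by
  obtain ⟨D, hD⟩ := hD
  -- Minimality of the leaves is used here: it reduces `Δ_b` to the Laplacian with `κ = 0`.
  have hκ : F.meanCurvatureForm g = 0 := hmin
  rw [hκ]
  refine ⟨fun W hW α hα => ⟨?_, ?_, ?_⟩, fun s W hW α hα h0 i => ⟨?_, ?_⟩,
    fun W hW α hα hαW => ⟨?_, ?_⟩⟩
  · exact FoliatedHodge.FoliatedReduction.isBasic_proj hD hW hα
  · exact FoliatedHodge.FoliatedReduction.isBasic_laplacian hD hG hα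
  · exact FoliatedHodge.FoliatedReduction.proj_laplacian hD hG hW hα
  · exact FoliatedHodge.FoliatedReduction.isBasic_proj hD (hW i).1 hα
  · rw [← FoliatedHodge.FoliatedReduction.proj_laplacian hD hG (hW i).1 hα, h0, B.proj_zero]
  · exact FoliatedHodge.FoliatedReduction.isBasic_laplacian hD hG hα
  · have h := FoliatedHodge.FoliatedReduction.proj_laplacian hD hG hW hα
    -- Since `P_W α = α`, commutation reads `P_W Δ_b α = Δ_b α`, which exhibits `Δ_b α` as a
    -- projection.
    rw [hαW.proj_eq] at h
    rw [← h]
    exact FoliatedHodge.FoliatedReduction.isOfType_proj hW _
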